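/- Let $d>1$ be a real number. In the $d$-choice process, balls are thrown one after another into $n$ initially empty bins; each ball goes, independently of the past, to the bin of rank $r\in\{1,\dots,n\}$ with probability $(r/n)^d-((r-1)/n)^d$, where the bins are ranked by decreasing current load and ties are broken by a fixed ordering of the bins. (For an integer $d$ this is the rule "sample $d$ bins uniformly and independently and put the ball in the least loaded of them".) For an integer $t\ge 0$, let $X^t_i$ be the load of bin $i$ after $tn$ balls minus the average $t$, and let $G^t=\max_i X^t_i$ be the gap. There are constants $a>0$ and $b$, depending only on $d$, such that $$\mathbb{E}\Big[\sum_{i=1}^n \exp(a|X^t_i|)\Big]\le bn\qquad\text{for all } n\ge 1,\ t\ge 0. \tag{1}$$ Moreover, for any such constants $a>0$ and $b$ (that is, whenever (1) holds) there is a constant $\gamma$, depending only on $d,a,b$, such that for all integers $n\ge 2$, all real $k\ge 0$ and all integers $t\ge (12\log n)/a$, $$\Pr\Big[G^t\ \ge\ \Big(5+\frac{10}{a}\Big)\log\log n+k+\gamma\Big]\ \le\ \frac{1}{n^{10}}+\frac{\exp(-ak)}{\log^4 n},$$ where $\log$ is the natural logarithm. -/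

import Mathlib

open MeasureTheory

namespace GreedyD

/-- The probability that a ball of the `d`-choice process goes to the bin of rank `r`, where the
bins are ranked from the heaviest (`r = 0`) to the lightest (`r = n - 1`). The total probability
of the `i` heaviest bins is `(i / n) ^ d`; here `d > 1` may be any real number. -/
noncomputable def rankProb (n : ℕ) (d : ℝ) (r : Fin n) : ℝ :=
  (((r : ℝ) + 1) / n) ^ d - ((r : ℝ) / n) ^ d

theorem rankProb_nonneg {n : ℕ} {d : ℝ} (hd : 1 < d) (r : Fin n) : 0 ≤ rankProb n d r := by
  unfold rankProb
  rw [sub_nonneg]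
  apply Real.rpow_le_rpow (by positivity) _ (by linarith)
  gcongr
  linarith

theorem sum_rankProb {n : ℕ} [NeZero n] {d : ℝ} (hd : 1 < d) :
    ∑ r : Fin n, ENNReal.ofReal (rankProb n d r) = 1 := by
  have hn : (n : ℝ) ≠ 0 := Nat.cast_ne_zero.mpr (NeZero.ne n)
  have hd0 : d ≠ 0 := by linarith
  rw [← ENNReal.ofReal_sum_of_nonneg (fun r _ => rankProb_nonneg hd r)]
  have h1 : ∑ r : Fin n, rankProb n d r = 1 := by
    unfold rankProb
    rw [Fin.sum_univ_eq_sum_range (fun r : ℕ => (((r : ℝ) + 1) / n) ^ d - ((r : ℝ) / n) ^ d) n]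
    have h := Finset.sum_range_sub (fun r : ℕ => ((r : ℝ) / n) ^ d) n
    simp only [Nat.cast_add, Nat.cast_one] at h
    rw [h, div_self hn]
    simp [Real.zero_rpow hd0]
  rw [h1, ENNReal.ofReal_one]

/-- The distribution of the rank of the bin that receives a ball. -/
noncomputable def rankPMF (n : ℕ) [NeZero n] (d : ℝ) (hd : 1 < d) : PMF (Fin n) :=
  PMF.ofFintype (fun r => ENNReal.ofReal (rankProb n d r)) (sum_rankProb hd)

/-- The bin of rank `r` when the loads are `x`: bins are sorted by decreasing load, ties being
broken by the fixed ordering of the bins. -/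
def binOfRank {n : ℕ} (x : Fin n → ℕ) (r : Fin n) : Fin n :=
  Tuple.sort (fun i => OrderDual.toDual (x i)) r

/-- The law of the loads of the `n` bins after `m` balls have been thrown sequentially by the
`d`-choice process into initially empty bins. -/
noncomputable def loadLaw (n : ℕ) [NeZero n] (d : ℝ) (hd : 1 < d) : ℕ → PMF (Fin n → ℕ)
  | 0 => PMF.pure 0
  | m + 1 => (loadLaw n d hd m).bind fun x =>
      (rankPMF n d hd).map fun r =>
        Function.update x (binOfRank x r) (x (binOfRank x r) + 1)

/-- The law of the loads after `t * n` balls, as a measure. -/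
noncomputable def lawAt (n : ℕ) [NeZero n] (d : ℝ) (hd : 1 < d) (t : ℕ) :
    Measure (Fin n → ℕ) :=
  (loadLaw n d hd (t * n)).toMeasure

/-- The normalized load of bin `i` after `t * n` balls: its load minus the average load `t`. -/
def normLoad {n : ℕ} (t : ℕ) (x : Fin n → ℕ) (i : Fin n) : ℝ := (x i : ℝ) - t

/-- The gap after `t * n` balls: the maximum load minus the average load `t`. -/
def gap {n : ℕ} (t : ℕ) (x : Fin n → ℕ) : ℝ := ((Finset.univ.sup x : ℕ) : ℝ) - t

/-- The constants `a > 0` and `b` bound the exponential potential of the `d`-choice process: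
`𝔼 [∑ i, exp (a |X i|)] ≤ b n` for every number of bins `n` and every time `t`. -/
def PotentialBound (d : ℝ) (hd : 1 < d) (a b : ℝ) : Prop :=
  0 < a ∧ ∀ (n : ℕ) [NeZero n] (t : ℕ),
    ∫⁻ x, ENNReal.ofReal (∑ i, Real.exp (a * |normLoad t x i|)) ∂(lawAt n d hd t)
      ≤ ENNReal.ofReal (b * n)

end GreedyD

/-! Ranks of successive balls are i.i.d. and the loads are a deterministic function of them.
Expectations are therefore finite sums over lists of ranks, and the number of balls of rank below a
fixed `K` is binomial, with no conditioning on loads.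

Existence of `a, b`: let `Φ = ∑ (exp (a X i) + exp (-a X i))` and `c = 1 - 2 (1/2)^d > 0`. To first
order in `a`, one ball changes `Φ` by `a ∑ (p r - 1/n) 2 sinh (a X r)`. Abel summation replaces `p`
by a bias of size `c / n` between the two halves of the ranking, and for centred sorted values this
bias controls `∑ |sinh|` (`sum_abs_sinh_le`). Hence `Φ` contracts by a factor `1 - Ω(1/n)` up to an
additive constant, which keeps its mean below `4 n`.

Tail bound: consider the last `M ≈ 12 log n / a` rounds of `n` balls. By Markov, with `h ≈ (5 log
log n) / a + k`, in all of them at most `W exp (-a i) n` bins exceed the average by `h + i`. Within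
a round, a bin can climb above a level only through balls whose rank is below the number of bins
already at that level. This yields the recursion of `numGE_le_of_recursion`, which `levelBound`
solves: the occupied fraction decays doubly exponentially in `i`, so about `log log n / log d`
levels above `h` only `n ^ δ` bins are left. During the whole window only `m = O(1)` balls have such
small ranks, and at its start every bin was below the final average, so the gap is at most `h + I +
m`.

The stated coefficient does not mention `log d`. The potential bound itself forces `1 / log d ≤ 5 +
5 / a` (`PotentialBound.inv_log_le`), since `a` cannot be large when `d` is near 1; with the `5 / a`
from `h` this gives `5 + 10 / a`. -/

namespace GreedyD

/-- The loads after one more ball, which goes to the bin of rank `r`. -/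
def step {n : ℕ} (x : Fin n → ℕ) (r : Fin n) : Fin n → ℕ :=
  Function.update x (binOfRank x r) (x (binOfRank x r) + 1)

/-- The loads after the balls whose ranks are listed, the most recent one first, have been thrown
into bins with loads `x`. -/
def run {n : ℕ} (x : Fin n → ℕ) : List (Fin n) → Fin n → ℕ
  | [] => x
  | r :: l => step (run x l) r

/-- The expectation of a function of the ranks of the first `m` balls, the most recent ball being
listed first. -/
noncomputable def expect (n : ℕ) (d : ℝ) : ℕ → (List (Fin n) → ℝ) → ℝ
  | 0, f => f []
  | m + 1, f => expect n d m fun l => ∑ r, rankProb n d r * f (r :: l)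

/-- The number of ranks in the list `l` that are less than `K`. -/
def countLT {n : ℕ} (K : ℕ) (l : List (Fin n)) : ℕ :=
  l.countP fun r => decide ((r : ℕ) < K)

theorem countLT_cons {n : ℕ} (K : ℕ) (r : Fin n) (l : List (Fin n)) :
    countLT K (r :: l) = countLT K l + if (r : ℕ) < K then 1 else 0 := by
  simp [countLT, List.countP_cons]

/-! ### Expectations over i.i.d. ranks, and the Chernoff bound -/

section Expect

variable {n : ℕ} {d : ℝ}

theorem sum_rankProb_real [NeZero n] (hd : 1 < d) : ∑ r : Fin n, rankProb n d r = 1 := by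
  have h := sum_rankProb (n := n) hd
  rw [← ENNReal.ofReal_sum_of_nonneg (fun r _ => rankProb_nonneg hd r)] at h
  exact ENNReal.ofReal_eq_one.mp h

theorem sum_rankProb_lt (hd : 1 < d) {K : ℕ} (hK : K ≤ n) :
    ∑ r : Fin n, (if (r : ℕ) < K then rankProb n d r else 0) = ((K : ℝ) / n) ^ d := by
  have hd0 : d ≠ 0 := by linarith
  unfold rankProb
  rw [Fin.sum_univ_eq_sum_range
    (fun r : ℕ => if r < K then (((r : ℝ) + 1) / n) ^ d - ((r : ℝ) / n) ^ d else 0) n,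
    ← Finset.sum_filter]
  have : (Finset.range n).filter (· < K) = Finset.range K := by
    ext r; simp; omega
  rw [this]
  have h := Finset.sum_range_sub (fun r : ℕ => ((r : ℝ) / n) ^ d) K
  simp only [Nat.cast_add, Nat.cast_one] at h
  rw [h]
  simp [Real.zero_rpow hd0]

theorem expect_mono (hd : 1 < d) (m : ℕ) {f g : List (Fin n) → ℝ} (h : ∀ l, f l ≤ g l) :
    expect n d m f ≤ expect n d m g := by
  induction m generalizing f g with
  | zero => exact h []
  | succ m ih =>
    exact ih fun l => Finset.sum_le_sum fun r _ =>
      mul_le_mul_of_nonneg_left (h _) (rankProb_nonneg hd r)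

theorem expect_add (m : ℕ) (f g : List (Fin n) → ℝ) :
    expect n d m (fun l => f l + g l) = expect n d m f + expect n d m g := by
  induction m generalizing f g with
  | zero => rfl
  | succ m ih => simp only [expect, mul_add, Finset.sum_add_distrib, ih]

theorem expect_const_mul (m : ℕ) (c : ℝ) (f : List (Fin n) → ℝ) :
    expect n d m (fun l => c * f l) = c * expect n d m f := by
  induction m generalizing f with
  | zero => rfl
  | succ m ih =>
    simp only [expect]
    rw [← ih]
    congr 1; ext l
    rw [Finset.mul_sum]
    exact Finset.sum_congr rfl fun r _ => by ring

theorem expect_const [NeZero n] (hd : 1 < d) (m : ℕ) (c : ℝ) :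
    expect n d m (fun _ => c) = c := by
  induction m with
  | zero => rfl
  | succ m ih => simp only [expect, ← Finset.sum_mul, sum_rankProb_real hd, one_mul, ih]

theorem expect_sum {ι : Type*} (s : Finset ι) (m : ℕ) (f : ι → List (Fin n) → ℝ) :
    expect n d m (fun l => ∑ i ∈ s, f i l) = ∑ i ∈ s, expect n d m (f i) := by
  classical
  induction s using Finset.induction_on with
  | empty =>
    have := expect_const_mul (n := n) (d := d) m 0 (fun _ => 0)
    simpa using this
  | insert i s hi ih => simp only [Finset.sum_insert hi, expect_add, ih]

theorem expect_nonneg (hd : 1 < d) (m : ℕ) {f : List (Fin n) → ℝ} (h : ∀ l, 0 ≤ f l) :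
    0 ≤ expect n d m f := by
  have := expect_mono hd m (f := fun _ => 0 * 0) (g := f) (by simpa using h)
  rw [expect_const_mul] at this
  simpa using this

theorem expect_drop [NeZero n] (hd : 1 < d) (m j : ℕ) (f : List (Fin n) → ℝ) :
    expect n d (m + j) (fun l => f (l.drop j)) = expect n d m f := by
  induction j with
  | zero => simp
  | succ j ih =>
    rw [← add_assoc]
    simp only [expect, List.drop_succ_cons, ← Finset.sum_mul, sum_rankProb_real hd, one_mul, ih]

/-- With `expect_drop`, this isolates any block of consecutive balls: the ranks in it are
distributed like those of the first balls. -/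
theorem expect_take [NeZero n] (hd : 1 < d) (m j : ℕ) (f : List (Fin n) → ℝ) :
    expect n d (m + j) (fun l => f (l.take j)) = expect n d j f := by
  induction j generalizing f with
  | zero => simpa [expect] using expect_const hd m (f [])
  | succ j ih =>
    rw [← add_assoc]
    simp only [expect, List.take_succ_cons]
    exact ih (fun l => ∑ r, rankProb n d r * f (r :: l))

theorem lintegral_loadLaw [NeZero n] (hd : 1 < d) (m : ℕ) (f : (Fin n → ℕ) → ENNReal) :
    ∫⁻ x, f x ∂(loadLaw n d hd m).toMeasure = ∑' x, f x * loadLaw n d hd m x := by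
  rw [lintegral_countable']
  simp only [PMF.toMeasure_apply_singleton _ _ (measurableSet_singleton _)]

theorem tsum_loadLaw_succ [NeZero n] (hd : 1 < d) (m : ℕ) (f : (Fin n → ℕ) → ENNReal) :
    ∑' x, f x * loadLaw n d hd (m + 1) x =
      ∑' x, (∑ r, ENNReal.ofReal (rankProb n d r) * f (step x r)) * loadLaw n d hd m x := by
  classical
  simp only [loadLaw, PMF.bind_apply, PMF.map_apply, ← ENNReal.tsum_mul_left]
  rw [ENNReal.tsum_comm]
  refine tsum_congr fun y => ?_
  rw [ENNReal.tsum_comm, tsum_fintype, Finset.sum_mul]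
  refine Finset.sum_congr rfl fun r _ => ?_
  rw [tsum_eq_single (step y r)]
  · rw [if_pos (by rfl)]
    simp only [rankPMF, PMF.ofFintype_apply]
    ring
  · intro x hx
    rw [if_neg (by exact hx)]
    simp

/-- The bridge from the Markov chain of loads to finite sums over ranks; all later probability is
done on the latter side. -/
theorem lintegral_loadLaw_ofReal [NeZero n] (hd : 1 < d) (m : ℕ) {f : (Fin n → ℕ) → ℝ}
    (hf : ∀ x, 0 ≤ f x) :
    ∫⁻ x, ENNReal.ofReal (f x) ∂(loadLaw n d hd m).toMeasure =
      ENNReal.ofReal (expect n d m fun l => f (run 0 l)) := by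
  rw [lintegral_loadLaw]
  induction m generalizing f with
  | zero =>
    classical
    simp only [loadLaw, PMF.pure_apply, expect, run]
    rw [tsum_eq_single 0]
    · simp
    · intro x hx; simp [hx]
  | succ m ih =>
    rw [tsum_loadLaw_succ]
    have : ∀ x, ∑ r, ENNReal.ofReal (rankProb n d r) * ENNReal.ofReal (f (step x r)) =
        ENNReal.ofReal (∑ r, rankProb n d r * f (step x r)) := by
      intro x
      rw [ENNReal.ofReal_sum_of_nonneg
        (fun r _ => mul_nonneg (rankProb_nonneg hd r) (hf _))]
      exact Finset.sum_congr rfl fun r _ => (ENNReal.ofReal_mul (rankProb_nonneg hd r)).symm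
    simp only [this]
    rw [ih fun x => Finset.sum_nonneg fun r _ => mul_nonneg (rankProb_nonneg hd r) (hf _)]
    rfl

theorem lawAt_real_eq_expect [NeZero n] (hd : 1 < d) (t : ℕ) (S : Set (Fin n → ℕ)) :
    (lawAt n d hd t).real S = expect n d (t * n) fun l => S.indicator 1 (run 0 l) := by
  have h := lintegral_loadLaw_ofReal hd (t * n) (f := S.indicator 1)
    (fun x => Set.indicator_nonneg (fun _ _ => zero_le_one) x)
  have h0 : 0 ≤ expect n d (t * n) fun l => S.indicator (1 : (Fin n → ℕ) → ℝ) (run 0 l) :=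
    expect_nonneg hd _ fun l => Set.indicator_nonneg (fun _ _ => zero_le_one) _
  have h2 : ∀ x, ENNReal.ofReal (S.indicator (1 : (Fin n → ℕ) → ℝ) x) =
      S.indicator (1 : (Fin n → ℕ) → ENNReal) x := by
    intro x
    by_cases hx : x ∈ S <;> simp [hx]
  simp only [h2] at h
  rw [lintegral_indicator_one (MeasurableSet.of_discrete)] at h
  rw [measureReal_def, lawAt, h, ENNReal.toReal_ofReal h0]

theorem run_append (x : Fin n → ℕ) (l l' : List (Fin n)) :
    run x (l ++ l') = run (run x l') l := by
  induction l with
  | nil => rfl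
  | cons r l ih => simp [run, ih]

theorem expect_exp_countP [NeZero n] (hd : 1 < d) (m : ℕ) {K : ℕ} (hK : K ≤ n) (c : ℝ) :
    expect n d m (fun l => Real.exp (c * (countLT K l : ℝ))) ≤
      Real.exp (m * ((K : ℝ) / n) ^ d * (Real.exp c - 1)) := by
  induction m with
  | zero => simp [expect, countLT]
  | succ m ih =>
    have h1 : ∀ l : List (Fin n), ∑ r, rankProb n d r *
        Real.exp (c * (countLT K (r :: l) : ℝ)) =
        (1 + ((K : ℝ) / n) ^ d * (Real.exp c - 1)) *
          Real.exp (c * (countLT K l : ℝ)) := by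
      intro l
      rw [← sum_rankProb_lt hd hK, Finset.sum_mul]
      nth_rewrite 1 [← sum_rankProb_real (n := n) hd]
      rw [← Finset.sum_add_distrib, Finset.sum_mul]
      refine Finset.sum_congr rfl fun r _ => ?_
      rw [countLT_cons]
      by_cases hr : (r : ℕ) < K
      · simp only [hr, if_true, Nat.cast_add, Nat.cast_one, mul_add, mul_one,
          Real.exp_add]
        ring
      · simp [hr]
    simp only [expect, h1, expect_const_mul]
    have h2 : (1 + ((K : ℝ) / n) ^ d * (Real.exp c - 1)) ≤
        Real.exp (((K : ℝ) / n) ^ d * (Real.exp c - 1)) := by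
      linarith [Real.add_one_le_exp (((K : ℝ) / n) ^ d * (Real.exp c - 1))]
    calc _ ≤ Real.exp (((K : ℝ) / n) ^ d * (Real.exp c - 1)) *
          Real.exp (m * ((K : ℝ) / n) ^ d * (Real.exp c - 1)) :=
          mul_le_mul h2 ih (expect_nonneg hd _ fun l => (Real.exp_pos _).le) (Real.exp_pos _).le
      _ = _ := by rw [← Real.exp_add]; congr 1; push_cast; ring

/-- The Chernoff bound for the number of balls of rank less than `K` among `m` balls. -/
theorem expect_indicator_countP [NeZero n] (hd : 1 < d) (m : ℕ) {K : ℕ} (hK : K ≤ n) {c : ℝ}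
    (hc : 0 ≤ c) (z : ℝ) :
    expect n d m ({l | z ≤ (countLT K l : ℝ)}.indicator 1) ≤
      Real.exp (m * ((K : ℝ) / n) ^ d * (Real.exp c - 1) - c * z) := by
  have h1 : ∀ l : List (Fin n),
      ({l : List (Fin n) | z ≤ (countLT K l : ℝ)}.indicator 1 l : ℝ) ≤
      Real.exp (-(c * z)) * Real.exp (c * (countLT K l : ℝ)) := by
    intro l
    rw [← Real.exp_add]
    refine Set.indicator_apply_le' (fun h => ?_) (fun _ => (Real.exp_pos _).le)
    rw [Pi.one_apply, Real.one_le_exp_iff]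
    have := mul_le_mul_of_nonneg_left (show z ≤ _ from h) hc
    linarith
  refine (expect_mono hd m h1).trans ?_
  rw [expect_const_mul]
  refine (mul_le_mul_of_nonneg_left (expect_exp_countP hd m hK c) (Real.exp_pos _).le).trans ?_
  rw [← Real.exp_add]
  apply le_of_eq; congr 1; ring

theorem PotentialBound.expect_le [NeZero n] {hd : 1 < d} {a b : ℝ} (h : PotentialBound d hd a b)
    (hb : 0 ≤ b) (t : ℕ) :
    expect n d (t * n) (fun l => ∑ i, Real.exp (a * |normLoad t (run 0 l) i|)) ≤ b * n := by
  have := h.2 n t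
  rw [lawAt, lintegral_loadLaw_ofReal hd (t * n)
    (fun x => Finset.sum_nonneg fun i _ => (Real.exp_pos _).le)] at this
  exact (ENNReal.ofReal_le_ofReal_iff (by positivity)).mp this

/-- A single bin at time 0 has potential exactly 1. -/
theorem PotentialBound.one_le {hd : 1 < d} {a b : ℝ} (h : PotentialBound d hd a b) : 1 ≤ b := by
  have := h.2 1 0
  rw [lawAt, lintegral_loadLaw_ofReal hd (0 * 1)
    (fun x => Finset.sum_nonneg fun i _ => (Real.exp_pos _).le)] at this
  simpa [expect, run, normLoad] using this

end Expect
-- Deterministic growth of the number of heavy bins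
section Deterministic

variable {n : ℕ}

/-- The number of bins with load at least `h`. -/
def numGE (x : Fin n → ℕ) (h : ℕ) : ℕ := (Finset.univ.filter fun i => h ≤ x i).card

theorem numGE_le (x : Fin n → ℕ) (h : ℕ) : numGE x h ≤ n := by
  simpa [numGE] using Finset.card_le_univ (Finset.univ.filter fun i => h ≤ x i)

theorem numGE_mono {x y : Fin n → ℕ} (hxy : x ≤ y) (h : ℕ) : numGE x h ≤ numGE y h := by
  refine Finset.card_le_card fun i hi => ?_
  simp only [Finset.mem_filter, Finset.mem_univ, true_and] at hi ⊢
  exact hi.trans (hxy i)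

theorem antitone_binOfRank (x : Fin n → ℕ) : Antitone fun r => x (binOfRank x r) := by
  intro r s hrs
  exact Tuple.monotone_sort (fun i => OrderDual.toDual (x i)) hrs

theorem binOfRank_injective (x : Fin n → ℕ) : Function.Injective (binOfRank x) :=
  (Tuple.sort fun i => OrderDual.toDual (x i)).injective

theorem sum_binOfRank {M : Type*} [AddCommMonoid M] (x : Fin n → ℕ) (f : Fin n → M) :
    ∑ r, f (binOfRank x r) = ∑ i, f i :=
  Equiv.sum_comp (Tuple.sort fun i => OrderDual.toDual (x i)) f

/-- A bin of rank `r` with load at least `h` is preceded by `r` bins with load at least `h`. -/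
theorem lt_numGE_of_le (x : Fin n → ℕ) {h : ℕ} {r : Fin n} (hr : h ≤ x (binOfRank x r)) :
    (r : ℕ) < numGE x h := by
  have h1 : (Finset.Iic r).image (binOfRank x) ⊆ Finset.univ.filter fun i => h ≤ x i := by
    intro i hi
    obtain ⟨s, hs, rfl⟩ := Finset.mem_image.mp hi
    simp only [Finset.mem_filter, Finset.mem_univ, true_and]
    exact hr.trans (antitone_binOfRank x (Finset.mem_Iic.mp hs))
  have h2 := Finset.card_le_card h1
  rw [Finset.card_image_of_injective _ (binOfRank_injective x), Fin.card_Iic] at h2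
  exact h2

theorem le_step (x : Fin n → ℕ) (r : Fin n) : x ≤ step x r := by
  intro i
  unfold step
  by_cases hi : i = binOfRank x r
  · subst hi; simp
  · simp [hi]

/-- Loads only grow, so a bound `K` at the end of `l` holds throughout. A ball lifting a bin from
`h` to `h + 1` hits one of the bins with load at least `h`, hence has rank below `K`. -/
theorem numGE_run_succ_le (x : Fin n → ℕ) (l : List (Fin n)) (h K : ℕ)
    (hK : numGE (run x l) h ≤ K) :
    numGE (run x l) (h + 1) ≤ numGE x (h + 1) + countLT K l := by
  induction l with
  | nil => simp [run]
  | cons r l ih =>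
    set y := run x l with hy
    have hyK : numGE y h ≤ K := (numGE_mono (le_step y r) h).trans hK
    specialize ih hyK
    have hrun : run x (r :: l) = step y r := rfl
    rw [hrun, countLT_cons]
    by_cases hr : h ≤ y (binOfRank y r)
    · rw [if_pos ((lt_numGE_of_le y hr).trans_le hyK)]
      have : numGE (step y r) (h + 1) ≤ numGE y (h + 1) + 1 := by
        have hsub : (Finset.univ.filter fun i => h + 1 ≤ step y r i) ⊆
            insert (binOfRank y r) (Finset.univ.filter fun i => h + 1 ≤ y i) := by
          intro i hi
          simp only [Finset.mem_filter, Finset.mem_univ, true_and, Finset.mem_insert] at hi ⊢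
          by_cases hir : i = binOfRank y r
          · exact Or.inl hir
          · right; simpa [step, hir] using hi
        exact (Finset.card_le_card hsub).trans (Finset.card_insert_le _ _)
      omega
    · have : numGE (step y r) (h + 1) ≤ numGE y (h + 1) := by
        refine Finset.card_le_card fun i hi => ?_
        simp only [Finset.mem_filter, Finset.mem_univ, true_and] at hi ⊢
        by_cases hir : i = binOfRank y r
        · subst hir; simp [step] at hi; omega
        · simpa [step, hir] using hi
      omega

/-- The same mechanism for one bin: once at height `h`, each further hit uses up a ball of rank
below `K`. -/
theorem run_le_max_add (x : Fin n → ℕ) (l : List (Fin n)) (h K : ℕ)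
    (hK : numGE (run x l) h ≤ K) (i : Fin n) :
    run x l i ≤ max (x i) h + countLT K l := by
  induction l with
  | nil => exact (le_max_left _ _).trans (Nat.le_add_right _ _)
  | cons r l ih =>
    set y := run x l with hy
    have hyK : numGE y h ≤ K := (numGE_mono (le_step y r) h).trans hK
    specialize ih hyK
    have hrun : run x (r :: l) = step y r := rfl
    rw [hrun, countLT_cons]
    by_cases hir : i = binOfRank y r
    · subst hir
      simp only [step, Function.update_self]
      by_cases hr : h ≤ y (binOfRank y r)
      · rw [if_pos ((lt_numGE_of_le y hr).trans_le hyK)]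
        omega
      · have : h ≤ max (x (binOfRank y r)) h := le_max_right _ _
        omega
    · simp only [step, Function.update_of_ne hir]
      omega

/-- Layered induction: if the numbers of heavily loaded bins obey the bound `α` initially and at
the lowest level, and few balls have small ranks in each round, then they obey it throughout.
Round `u` counts backwards from the end of the list `l`, and `α i s` is the bound for the level `i`
after `s` of the last `M` rounds. -/
theorem numGE_le_of_recursion (l : List (Fin n)) (T M h : ℕ) {d ε : ℝ}
    (hd : 0 ≤ d) (hn : 0 < n) (α : ℕ → ℕ → ℝ)
    (hinit : ∀ i, (numGE (run 0 (l.drop (M * n))) (T + h + i) : ℝ) ≤ α i 0 * n)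
    (hbase : ∀ s ≤ M, (numGE (run 0 (l.drop ((M - s) * n))) (T + s + h) : ℝ) ≤ α 0 s * n)
    (hround : ∀ u < M, ∀ K ≤ n,
      (countLT K ((l.drop (u * n)).take n) : ℝ) ≤ (2 * ((K : ℝ) / n) ^ d + ε) * n)
    (hα : ∀ i s, s < M → 2 * α i (s + 1) ^ d + ε + α (i + 2) s ≤ α (i + 1) (s + 1))
    (s : ℕ) (hs : s ≤ M) (i : ℕ) :
    (numGE (run 0 (l.drop ((M - s) * n))) (T + s + h + i) : ℝ) ≤ α i s * n := by
  have hn' : (0 : ℝ) < n := by exact_mod_cast hn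
  induction s generalizing i with
  | zero => simpa using hinit i
  | succ s ihs =>
    induction i with
    | zero => exact hbase (s + 1) hs
    | succ i ihi =>
      set u := M - (s + 1) with hu
      have hus : M - s = u + 1 := by omega
      have hsplit : l.drop (u * n) = (l.drop (u * n)).take n ++ l.drop ((u + 1) * n) := by
        rw [add_mul, one_mul, ← List.drop_drop, List.take_append_drop]
      have hrun : run 0 (l.drop (u * n)) =
          run (run 0 (l.drop ((u + 1) * n))) ((l.drop (u * n)).take n) := by
        rw [← run_append, ← hsplit]
      set K := numGE (run 0 (l.drop (u * n))) (T + (s + 1) + h + i) with hKdef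
      have h1 := numGE_run_succ_le (run 0 (l.drop ((u + 1) * n))) ((l.drop (u * n)).take n)
        (T + (s + 1) + h + i) K (by rw [← hrun])
      rw [← hrun] at h1
      -- The average rises by 1 per round, so level `i + 1` after `s + 1` rounds is the same
      -- absolute load as level `i + 2` after `s` rounds.
      have h2 := ihs (by omega) (i + 2)
      rw [hus, show T + s + h + (i + 2) = T + (s + 1) + h + i + 1 by ring] at h2
      have h3 := hround u (by omega) K (numGE_le _ _)
      have h4 : ((K : ℝ) / n) ^ d ≤ α i (s + 1) ^ d := by
        refine Real.rpow_le_rpow (by positivity) ?_ hd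
        rw [div_le_iff₀ hn']
        exact ihi
      have h5 := hα i s (by omega)
      have h1' : (numGE (run 0 (l.drop (u * n))) (T + (s + 1) + h + (i + 1)) : ℝ) ≤
          numGE (run 0 (l.drop ((u + 1) * n))) (T + (s + 1) + h + i + 1) +
            countLT K ((l.drop (u * n)).take n) := by exact_mod_cast h1
      have h6 := mul_le_mul_of_nonneg_right h5 hn'.le
      have h7 := mul_le_mul_of_nonneg_right h4 hn'.le
      nlinarith

end Deterministic
-- The bias towards light bins, measured by sinh
section Drift

variable {n : ℕ}

/-- The sign that is `1` on the first half of `Fin n`, `-1` on the last half and `0` on the middle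
element if there is one. -/
noncomputable def halfSign (n r : ℕ) : ℝ :=
  (if r < n / 2 then 1 else 0) - (if n - n / 2 ≤ r then 1 else 0)

theorem halfSign_le_one (n r : ℕ) : halfSign n r ≤ 1 := by
  unfold halfSign; split_ifs <;> norm_num

theorem neg_one_le_halfSign (n r : ℕ) : -1 ≤ halfSign n r := by
  unfold halfSign; split_ifs <;> norm_num

theorem halfSign_reflect {r : ℕ} (hr : r < n) : halfSign n (n - 1 - r) = -halfSign n r := by
  unfold halfSign
  have h1 : n - 1 - r < n / 2 ↔ n - n / 2 ≤ r := by omega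
  have h2 : n - n / 2 ≤ n - 1 - r ↔ r < n / 2 := by omega
  simp only [h1, h2]
  ring

theorem sum_halfSign (n : ℕ) : ∑ r ∈ Finset.range n, halfSign n r = 0 := by
  have h := Finset.sum_range_reflect (halfSign n) n
  rw [Finset.sum_congr rfl fun r hr => halfSign_reflect (Finset.mem_range.mp hr),
    Finset.sum_neg_distrib] at h
  linarith

theorem sum_halfSign_le {k : ℕ} (hk : k ≤ n) :
    ∑ r ∈ Finset.range k, halfSign n r ≤ k ∧ ∑ r ∈ Finset.range k, halfSign n r ≤ n - k := by
  constructor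
  · simpa using Finset.sum_le_card_nsmul (Finset.range k) (halfSign n) 1
      fun r _ => halfSign_le_one n r
  · have h1 := Finset.sum_range_add_sum_Ico (halfSign n) hk
    rw [sum_halfSign] at h1
    have h2 := Finset.card_nsmul_le_sum (Finset.Ico k n) (halfSign n) (-1)
      fun r _ => neg_one_le_halfSign n r
    rw [Nat.card_Ico, nsmul_eq_mul, Nat.cast_sub hk] at h2
    linarith

/-- Abel summation: weights with nonnegative partial sums and zero total correlate nonnegatively
with an antitone sequence. -/
theorem sum_mul_nonneg_of_antitone {q : ℕ → ℝ} {φ : Fin n → ℝ} (hφ : Antitone φ)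
    (hq : ∀ k ≤ n, 0 ≤ ∑ i ∈ Finset.range k, q i) (hq0 : ∑ i ∈ Finset.range n, q i = 0) :
    0 ≤ ∑ r : Fin n, q r * φ r := by
  set φ' : ℕ → ℝ := fun i => if h : i < n then φ ⟨i, h⟩ else 0 with hφ'
  have h1 : ∑ r : Fin n, q r * φ r = ∑ i ∈ Finset.range n, φ' i • q i := by
    rw [← Fin.sum_univ_eq_sum_range (fun i => φ' i • q i) n]
    refine Finset.sum_congr rfl fun r _ => ?_
    simp [hφ', mul_comm]
  rw [h1, Finset.sum_range_by_parts, hq0, smul_zero, zero_sub, ← Finset.sum_neg_distrib]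
  refine Finset.sum_nonneg fun i hi => ?_
  rw [Finset.mem_range] at hi
  rw [smul_eq_mul, ← neg_mul]
  refine mul_nonneg ?_ (hq _ (by omega))
  have hi1 : i + 1 < n := by omega
  have hi2 : i < n := by omega
  simp only [hφ', hi1, hi2, dif_pos]
  have : φ ⟨i + 1, hi1⟩ ≤ φ ⟨i, hi2⟩ := hφ (by simp [Fin.le_def])
  linarith

/-- The concave function `ρ - ρ ^ d` vanishes at 0 and 1, so it lies above its chords over `[0,
1/2]` and `[1/2, 1]`. The resulting tent also bounds the partial sums of `halfSign`. -/
theorem sub_rpow_ge {d ρ : ℝ} (hd : 1 < d) (h0 : 0 ≤ ρ) (h1 : ρ ≤ 1) :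
    (1 - 2 * (1 / 2 : ℝ) ^ d) * min ρ (1 - ρ) ≤ ρ - ρ ^ d := by
  have hc := convexOn_rpow hd.le
  have hp : (0 : ℝ) < (1 / 2 : ℝ) ^ d := by positivity
  rcases le_total ρ (1 / 2) with h | h
  · rw [min_eq_left (by linarith)]
    have := hc.2 (show (0 : ℝ) ∈ Set.Ici 0 by simp) (show (1 / 2 : ℝ) ∈ Set.Ici 0 by simp)
      (show 0 ≤ 1 - 2 * ρ by linarith) (show 0 ≤ 2 * ρ by linarith) (by ring)
    simp only [smul_eq_mul, mul_zero, zero_add] at this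
    rw [show 2 * ρ * (1 / 2) = ρ by ring, Real.zero_rpow (by linarith)] at this
    linarith
  · rw [min_eq_right (by linarith)]
    have := hc.2 (show (1 / 2 : ℝ) ∈ Set.Ici 0 by simp) (show (1 : ℝ) ∈ Set.Ici 0 by simp)
      (show 0 ≤ 2 - 2 * ρ by linarith) (show 0 ≤ 2 * ρ - 1 by linarith) (by ring)
    simp only [smul_eq_mul] at this
    rw [show (2 - 2 * ρ) * (1 / 2) + (2 * ρ - 1) * 1 = ρ by ring, Real.one_rpow] at this
    linarith

theorem one_sub_two_mul_half_rpow_mem {d : ℝ} (hd : 1 < d) :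
    0 < 1 - 2 * (1 / 2 : ℝ) ^ d ∧ 1 - 2 * (1 / 2 : ℝ) ^ d ≤ 1 := by
  have h1 : (1 / 2 : ℝ) ^ d < (1 / 2 : ℝ) ^ (1 : ℝ) :=
    Real.rpow_lt_rpow_of_exponent_gt (by norm_num) (by norm_num) hd
  have h2 : (0 : ℝ) < (1 / 2 : ℝ) ^ d := by positivity
  rw [Real.rpow_one] at h1
  constructor <;> linarith

/-- The rank probabilities favour low loads at least as much as a fixed bias between the two
halves of the bins does. -/
theorem sum_halfSign_mul_le {d : ℝ} (hd : 1 < d) {φ : Fin n → ℝ} (hφ : Antitone φ) :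
    (1 - 2 * (1 / 2 : ℝ) ^ d) * (1 / n) * ∑ r : Fin n, halfSign n r * φ r ≤
      ∑ r : Fin n, (1 / n - rankProb n d r) * φ r := by
  rcases Nat.eq_zero_or_pos n with rfl | hn
  · simp
  have hn' : (0 : ℝ) < n := by exact_mod_cast hn
  have hd0 : d ≠ 0 := by linarith
  set c := 1 - 2 * (1 / 2 : ℝ) ^ d with hc
  have hc0 : 0 < c := (one_sub_two_mul_half_rpow_mem hd).1
  set q : ℕ → ℝ := fun i =>
    1 / n - ((((i : ℝ) + 1) / n) ^ d - ((i : ℝ) / n) ^ d) - c * (1 / n) * halfSign n i with hq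
  have hsum : ∀ k, ∑ i ∈ Finset.range k, q i =
      (k : ℝ) / n - ((k : ℝ) / n) ^ d - c * (1 / n) * ∑ i ∈ Finset.range k, halfSign n i := by
    intro k
    have h := Finset.sum_range_sub (fun r : ℕ => ((r : ℝ) / n) ^ d) k
    simp only [Nat.cast_add, Nat.cast_one] at h
    simp only [hq, Finset.sum_sub_distrib, h, ← Finset.mul_sum]
    simp [Real.zero_rpow hd0, div_eq_mul_inv]
  have := sum_mul_nonneg_of_antitone (q := q) hφ ?_ ?_
  · have h2 : ∑ r : Fin n, q r * φ r = ∑ r : Fin n, (1 / n - rankProb n d r) * φ r -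
        c * (1 / n) * ∑ r : Fin n, halfSign n r * φ r := by
      rw [Finset.mul_sum, ← Finset.sum_sub_distrib]
      refine Finset.sum_congr rfl fun r _ => ?_
      simp only [hq, rankProb]; ring
    linarith
  · intro k hk
    rw [hsum]
    have h1 := sum_halfSign_le hk
    have hk' : (k : ℝ) ≤ n := by exact_mod_cast hk
    have h2 := sub_rpow_ge (ρ := (k : ℝ) / n) hd (by positivity) (by rwa [div_le_one hn'])
    have h3 : (1 / n : ℝ) * ∑ i ∈ Finset.range k, halfSign n i ≤
        min ((k : ℝ) / n) (1 - (k : ℝ) / n) := by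
      rw [one_div, inv_mul_eq_div]
      refine le_min ?_ ?_
      · gcongr; exact h1.1
      · rw [div_le_iff₀ hn', sub_mul, div_mul_cancel₀ _ hn'.ne', one_mul]; exact h1.2
    have h4 := mul_le_mul_of_nonneg_left h3 hc0.le
    rw [← mul_assoc] at h4
    linarith
  · rw [hsum, sum_halfSign, div_self hn'.ne', Real.one_rpow]; ring

theorem convexOn_sinh : ConvexOn ℝ (Set.Ici 0) Real.sinh := by
  refine convexOn_of_deriv2_nonneg (convex_Ici 0) Real.continuous_sinh.continuousOn
    Real.differentiable_sinh.differentiableOn ?_ ?_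
  · simpa using Real.differentiable_cosh.differentiableOn
  · intro x hx
    rw [interior_Ici, Set.mem_Ioi] at hx
    simpa using hx.le

theorem sinh_tangent_le {m w : ℝ} (hm : 0 ≤ m) (hw : 0 ≤ w) :
    Real.sinh m + Real.cosh m * (w - m) ≤ Real.sinh w := by
  rcases lt_trichotomy m w with h | h | h
  · have := convexOn_sinh.le_slope_of_hasDerivAt (Set.mem_Ici.mpr hm) (Set.mem_Ici.mpr hw) h
      (Real.hasDerivAt_sinh m)
    rw [slope_def_field, le_div_iff₀ (by linarith)] at this
    linarith
  · simp [h]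
  · have := convexOn_sinh.slope_le_of_hasDerivAt (Set.mem_Ici.mpr hw) (Set.mem_Ici.mpr hm) h
      (Real.hasDerivAt_sinh m)
    rw [slope_def_field, div_le_iff₀ (by linarith)] at this
    linarith

theorem sum_fin_halfSign (n : ℕ) : ∑ r : Fin n, halfSign n r = 0 := by
  rw [Fin.sum_univ_eq_sum_range (halfSign n) n, sum_halfSign]

/-- The left side is `P + N + Q` and the signed sum is `P + N - R`, where `P` is the top half, `N`
and `Q` are the negative and positive parts from rank `n / 2` on, and `R` is the part of `Q` in the
last half. The factor 3 follows from `R ≤ P` and `R ≤ Q ≤ N`. -/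
theorem sum_abs_sinh_le_of_pivot {z : Fin n → ℝ} (hz : ∑ r, z r = 0) {m : ℝ} (hm : 0 ≤ m)
    (htop : ∀ r : Fin n, (r : ℕ) < n / 2 → m ≤ z r)
    (hbot : ∀ r : Fin n, n / 2 ≤ (r : ℕ) → z r ≤ m)
    (hmid : ∀ r : Fin n, n / 2 ≤ (r : ℕ) → (r : ℕ) < n - n / 2 → 0 ≤ z r)
    (hsum : ∑ r : Fin n, (if n / 2 ≤ (r : ℕ) then m else 0) ≤ ∑ r, max (z r) 0) :
    ∑ r, |Real.sinh (z r)| ≤ 3 * ∑ r : Fin n, halfSign n r * Real.sinh (z r) := by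
  set P := ∑ r : Fin n, (if (r : ℕ) < n / 2 then Real.sinh (z r) else 0) with hP
  set N := ∑ r : Fin n, (if n / 2 ≤ (r : ℕ) then Real.sinh (max (-z r) 0) else 0) with hN
  set Q := ∑ r : Fin n, (if n / 2 ≤ (r : ℕ) then Real.sinh (max (z r) 0) else 0) with hQ
  set R := ∑ r : Fin n, (if n - n / 2 ≤ (r : ℕ) then Real.sinh (max (z r) 0) else 0) with hR
  have hsm : 0 ≤ Real.sinh m := Real.sinh_nonneg_iff.mpr hm
  have habs : ∑ r, |Real.sinh (z r)| = P + N + Q := by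
    rw [hP, hN, hQ, ← Finset.sum_add_distrib, ← Finset.sum_add_distrib]
    refine Finset.sum_congr rfl fun r _ => ?_
    by_cases hr : (r : ℕ) < n / 2
    · rw [if_pos hr, if_neg (by omega), if_neg (by omega),
        abs_of_nonneg (Real.sinh_nonneg_iff.mpr (hm.trans (htop r hr)))]
      ring
    · rw [if_neg hr, if_pos (by omega), if_pos (by omega)]
      rcases le_total 0 (z r) with h | h
      · rw [max_eq_right (by linarith), max_eq_left h,
          abs_of_nonneg (Real.sinh_nonneg_iff.mpr h)]
        simp
      · rw [max_eq_left (by linarith), max_eq_right h,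
          abs_of_nonpos (Real.sinh_nonpos_iff.mpr h)]
        simp
  have hT : ∑ r : Fin n, halfSign n r * Real.sinh (z r) = P + N - R := by
    rw [hP, hN, hR, ← Finset.sum_add_distrib, ← Finset.sum_sub_distrib]
    refine Finset.sum_congr rfl fun r _ => ?_
    unfold halfSign
    by_cases hr : (r : ℕ) < n / 2
    · simp only [if_pos hr, if_neg (show ¬ n / 2 ≤ (r : ℕ) by omega),
        if_neg (show ¬ n - n / 2 ≤ (r : ℕ) by omega)]
      ring
    · simp only [if_neg hr, if_pos (show n / 2 ≤ (r : ℕ) by omega)]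
      by_cases hr2 : n - n / 2 ≤ (r : ℕ)
      · simp only [if_pos hr2]
        rcases le_total 0 (z r) with h | h
        · rw [max_eq_right (by linarith), max_eq_left h]; simp
        · rw [max_eq_left (by linarith), max_eq_right h]; simp
      · have h := hmid r (by omega) (by omega)
        simp only [if_neg hr2]
        rw [max_eq_right (by linarith)]; simp
  have hRQ : R ≤ Q := by
    refine Finset.sum_le_sum fun r _ => ?_
    have : 0 ≤ Real.sinh (max (z r) 0) := Real.sinh_nonneg_iff.mpr (le_max_right _ _)
    split_ifs <;> first | omega | linarith
  have hRP : R ≤ P := by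
    have h1 : ∑ r : Fin n, halfSign n r * Real.sinh m = 0 := by
      rw [← Finset.sum_mul, sum_fin_halfSign, zero_mul]
    have h2 : R - P ≤ -∑ r : Fin n, halfSign n r * Real.sinh m := by
      rw [hR, hP, ← Finset.sum_sub_distrib, ← Finset.sum_neg_distrib]
      refine Finset.sum_le_sum fun r _ => ?_
      unfold halfSign
      by_cases hr : (r : ℕ) < n / 2
      · simp only [if_pos hr, if_neg (show ¬ n - n / 2 ≤ (r : ℕ) by omega)]
        have := Real.sinh_le_sinh.mpr (htop r hr)
        linarith
      · simp only [if_neg hr]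
        split_ifs
        · have := Real.sinh_le_sinh.mpr (max_le (hbot r (by omega)) hm)
          linarith
        · simp
    linarith
  -- Positive and negative parts of `z` have equal total. The positive entries below the pivot are
  -- at most `m`, and the tangent to sinh at `m` bounds the negative parts from below; `hsum` makes
  -- the linear term nonnegative.
  have hQN : Q ≤ N := by
    have h1 : ∑ r, max (-z r) 0 = ∑ r, max (z r) 0 := by
      have : ∑ r, (max (z r) 0 - max (-z r) 0) = ∑ r, z r :=
        Finset.sum_congr rfl fun r _ => by
          rcases le_total 0 (z r) with h | h
          · rw [max_eq_left h, max_eq_right (by linarith)]; ring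
          · rw [max_eq_right h, max_eq_left (by linarith)]; ring
      rw [Finset.sum_sub_distrib, hz] at this
      linarith
    have h2 : Real.cosh m * (∑ r, max (-z r) 0 -
        ∑ r : Fin n, (if n / 2 ≤ (r : ℕ) then m else 0)) ≤ N - Q := by
      rw [hN, hQ, ← Finset.sum_sub_distrib, ← Finset.sum_sub_distrib, Finset.mul_sum]
      refine Finset.sum_le_sum fun r _ => ?_
      by_cases hr : (r : ℕ) < n / 2
      · have := htop r hr
        simp only [if_neg (show ¬ n / 2 ≤ (r : ℕ) by omega)]
        rw [max_eq_right (by linarith)]; simp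
      · simp only [if_pos (show n / 2 ≤ (r : ℕ) by omega)]
        have h3 := Real.sinh_le_sinh.mpr (max_le (hbot r (by omega)) hm)
        have h4 := sinh_tangent_le hm (le_max_right (-z r) 0)
        linarith
    have h3 : 0 ≤ Real.cosh m * (∑ r, max (-z r) 0 -
        ∑ r : Fin n, (if n / 2 ≤ (r : ℕ) then m else 0)) :=
      mul_nonneg (Real.cosh_pos m).le (by rw [h1]; linarith)
    linarith
  rw [habs, hT]
  linarith

theorem sum_abs_sinh_le_of_nonneg {z : Fin n → ℝ} (hz : ∑ r, z r = 0) (hz' : Antitone z)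
    (hn : n / 2 < n) (hm : 0 ≤ z ⟨n / 2, hn⟩) :
    ∑ r, |Real.sinh (z r)| ≤ 3 * ∑ r : Fin n, halfSign n r * Real.sinh (z r) := by
  refine sum_abs_sinh_le_of_pivot hz hm (fun r hr => hz' (Fin.le_def.mpr hr.le))
    (fun r hr => hz' (Fin.le_def.mpr hr)) (fun r h1 h2 => ?_) ?_
  · have : r = ⟨n / 2, hn⟩ := Fin.ext (by simp; omega)
    rwa [this]
  · set m := z ⟨n / 2, hn⟩
    have h1 : ∑ r : Fin n, halfSign n r * m = 0 := by
      rw [← Finset.sum_mul, sum_fin_halfSign, zero_mul]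
    have h2 : ∑ r : Fin n, ((if n / 2 ≤ (r : ℕ) then m else 0) + halfSign n r * m) ≤
        ∑ r, max (z r) 0 := by
      refine Finset.sum_le_sum fun r _ => ?_
      unfold halfSign
      by_cases hr : (r : ℕ) < n / 2
      · simp only [if_pos hr, if_neg (show ¬ n / 2 ≤ (r : ℕ) by omega),
          if_neg (show ¬ n - n / 2 ≤ (r : ℕ) by omega)]
        have : m ≤ z r := hz' (Fin.le_def.mpr hr.le)
        have := le_max_left (z r) 0
        linarith
      · simp only [if_neg hr, if_pos (show n / 2 ≤ (r : ℕ) by omega)]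
        split_ifs with hr2
        · simp
        · have : r = ⟨n / 2, hn⟩ := Fin.ext (by simp; omega)
          have h3 : z r = m := by rw [this]
          have := le_max_left (z r) 0
          linarith
    rw [Finset.sum_add_distrib, h1, add_zero] at h2
    exact h2

/-- If the entry at `n / 2` is nonnegative, it is the pivot. If its mirror image is nonpositive,
`-z` reversed is in the first case. Otherwise `n` is even and the sign changes exactly between the
halves, so the pivot is 0. -/
theorem sum_abs_sinh_le {z : Fin n → ℝ} (hz : ∑ r, z r = 0) (hz' : Antitone z) :
    ∑ r, |Real.sinh (z r)| ≤ 3 * ∑ r : Fin n, halfSign n r * Real.sinh (z r) := by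
  rcases Nat.eq_zero_or_pos n with rfl | hn
  · simp
  have hh : n / 2 < n := by omega
  by_cases h0 : 0 ≤ z ⟨n / 2, hh⟩
  · exact sum_abs_sinh_le_of_nonneg hz hz' hh h0
  push Not at h0
  by_cases h1 : z ⟨n - 1 - n / 2, by omega⟩ ≤ 0
  · have hs : ∑ r, -z (Fin.rev r) = 0 := by
      have := Equiv.sum_comp Fin.revPerm fun r => -z r
      rw [Finset.sum_neg_distrib (f := z), hz, neg_zero] at this
      exact this
    have ha : Antitone fun r => -z (Fin.rev r) := fun r s hrs =>
      neg_le_neg (hz' (Fin.rev_le_rev.mpr hrs))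
    have h2 := sum_abs_sinh_le_of_nonneg hs ha hh (by
      have : Fin.rev ⟨n / 2, hh⟩ = ⟨n - 1 - n / 2, by omega⟩ := Fin.ext (by simp; omega)
      rw [this]; linarith)
    have h3 : ∑ r : Fin n, |Real.sinh (-z (Fin.rev r))| = ∑ r, |Real.sinh (z r)| := by
      simp only [Real.sinh_neg, abs_neg]
      exact Equiv.sum_comp Fin.revPerm (fun r => |Real.sinh (z r)|)
    have h4 : ∑ r : Fin n, halfSign n r * Real.sinh (-z (Fin.rev r)) =
        ∑ r : Fin n, halfSign n r * Real.sinh (z r) := by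
      rw [← Equiv.sum_comp Fin.revPerm (fun r : Fin n => halfSign n r * Real.sinh (z r))]
      refine Finset.sum_congr rfl fun r _ => ?_
      have := halfSign_reflect r.2
      have h5 : ((Fin.revPerm r : Fin n) : ℕ) = n - 1 - r := by simp; omega
      rw [h5, this, Real.sinh_neg]; simp
    rwa [h3, h4] at h2
  · push Not at h1
    have hne : n - 1 - n / 2 ≠ n / 2 := by
      intro h
      have : (⟨n - 1 - n / 2, by omega⟩ : Fin n) = ⟨n / 2, hh⟩ := Fin.ext h
      rw [this] at h1; linarith
    refine sum_abs_sinh_le_of_pivot hz le_rfl (fun r hr => ?_) (fun r hr => ?_)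
      (fun r h2 h3 => by omega) ?_
    · exact h1.le.trans (hz' (Fin.le_def.mpr (by simp; omega)))
    · exact (hz' (Fin.le_def.mpr hr)).trans h0.le
    · simpa using Finset.sum_nonneg fun r _ => le_max_right (z r) 0

end Drift
-- Contraction of the potential, and what a potential bound says about `d`
section Potential

variable {n : ℕ}

/-- Second-order expansion of the mean factor by which one ball changes `exp (a X)`, for a bin hit
with probability `p`, with `v = 1 / n`. The sign of `a` is free because both exponentials of the
potential need it. -/
theorem exp_neg_mul_le {d a p v : ℝ} (hd : 1 ≤ d) (ha : |a| * (2 * d + 1) ≤ 1) (hv0 : 0 ≤ v)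
    (hv1 : v ≤ 1) (hp0 : 0 ≤ p) (hp : p ≤ d * v) :
    Real.exp (-(a * v)) * (1 + p * (Real.exp a - 1)) ≤
      1 + a * (p - v) + 10 * d ^ 2 * a ^ 2 * v := by
  have ha0 := abs_nonneg a
  have ha1 : |a| ≤ 1 := by nlinarith
  have h1 := (abs_le.mp (Real.abs_exp_sub_one_sub_id_le ha1)).2
  have h2 : 1 + p * (Real.exp a - 1) ≤ Real.exp (p * (a + a ^ 2)) := by
    have := Real.add_one_le_exp (p * (a + a ^ 2))
    nlinarith
  have h3 : Real.exp (-(a * v)) * (1 + p * (Real.exp a - 1)) ≤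
      Real.exp (a * (p - v) + p * a ^ 2) := by
    refine (mul_le_mul_of_nonneg_left h2 (Real.exp_pos _).le).trans (le_of_eq ?_)
    rw [← Real.exp_add]; congr 1; ring
  have hsq : a ^ 2 ≤ |a| := by rw [← sq_abs]; nlinarith
  have hw : |a * (p - v) + p * a ^ 2| ≤ |a| * (2 * d + 1) * v := by
    have hpv : |p - v| ≤ (d + 1) * v := by
      rw [abs_le]; constructor <;> nlinarith
    calc _ ≤ |a * (p - v)| + |p * a ^ 2| := abs_add_le _ _
      _ ≤ |a| * ((d + 1) * v) + (d * v) * |a| := by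
          rw [abs_mul, abs_of_nonneg (mul_nonneg hp0 (sq_nonneg a))]
          gcongr
      _ = _ := by ring
  have hw1 : |a * (p - v) + p * a ^ 2| ≤ 1 := by nlinarith
  have h4 := (abs_le.mp (Real.abs_exp_sub_one_sub_id_le hw1)).2
  have h5 : (a * (p - v) + p * a ^ 2) ^ 2 ≤ a ^ 2 * (2 * d + 1) ^ 2 * v := by
    rw [← sq_abs]
    calc _ ≤ (|a| * (2 * d + 1) * v) ^ 2 := by gcongr
      _ = a ^ 2 * (2 * d + 1) ^ 2 * (v * v) := by rw [mul_pow, mul_pow, sq_abs]; ring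
      _ ≤ a ^ 2 * (2 * d + 1) ^ 2 * v := by gcongr; nlinarith
  have h6 : p * a ^ 2 ≤ d * v * a ^ 2 := by gcongr
  have h8 : d + (2 * d + 1) ^ 2 ≤ 10 * d ^ 2 := by nlinarith
  have h9 : a ^ 2 * v * (d + (2 * d + 1) ^ 2) ≤ a ^ 2 * v * (10 * d ^ 2) := by gcongr
  linarith

/-- Bernoulli's inequality for `(1 - 1 / (r + 1)) ^ d`. -/
theorem rankProb_le [NeZero n] {d : ℝ} (hd : 1 < d) (r : Fin n) :
    rankProb n d r ≤ d * (1 / n) := by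
  have hn : (0 : ℝ) < n := by exact_mod_cast Nat.pos_of_ne_zero (NeZero.ne n)
  have hr : (r : ℝ) + 1 ≤ n := by exact_mod_cast r.2
  have hr0 : (0 : ℝ) ≤ r := by positivity
  set u := ((r : ℝ) + 1) / n with hu
  have hu0 : 0 < u := by positivity
  have hu1 : u ≤ 1 := by rwa [hu, div_le_one hn]
  have hs : -1 ≤ -(1 / ((r : ℝ) + 1)) := by
    rw [neg_le_neg_iff, div_le_one (by positivity)]; linarith
  have h1 := one_add_mul_self_le_rpow_one_add hs hd.le
  have h2 : (r : ℝ) / n = u * (1 + -(1 / ((r : ℝ) + 1))) := by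
    rw [hu]; field_simp; ring
  have h3 : u ^ d ≤ u := by
    simpa using Real.rpow_le_rpow_of_exponent_ge hu0 hu1 hd.le
  have h4 : u ^ d * (1 / ((r : ℝ) + 1)) ≤ 1 / n := by
    calc _ ≤ u * (1 / ((r : ℝ) + 1)) := by gcongr
      _ = 1 / n := by rw [hu]; field_simp
  have h5 : u ^ d * (1 + d * -(1 / ((r : ℝ) + 1))) ≤ ((r : ℝ) / n) ^ d := by
    rw [h2, Real.mul_rpow hu0.le (by linarith)]
    gcongr
  unfold rankProb
  have h6 : d * (u ^ d * (1 / ((r : ℝ) + 1))) ≤ d * (1 / n) := by gcongr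
  rw [← hu]
  linarith

/-- The load of bin `i` minus the average load. -/
noncomputable def excess (x : Fin n → ℕ) (i : Fin n) : ℝ := x i - (∑ j, (x j : ℝ)) / n

/-- The potential `∑ i, (exp (a X i) + exp (-a X i))`, where `X i` is the load of bin `i` minus the
average load. -/
noncomputable def potential (a : ℝ) (x : Fin n → ℕ) : ℝ :=
  ∑ i, (Real.exp (a * excess x i) + Real.exp (-a * excess x i))

theorem sum_excess [NeZero n] (x : Fin n → ℕ) : ∑ i, excess x i = 0 := by
  have hn : (n : ℝ) ≠ 0 := Nat.cast_ne_zero.mpr (NeZero.ne n)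
  simp only [excess, Finset.sum_sub_distrib, Finset.sum_const, Finset.card_univ, Fintype.card_fin,
    nsmul_eq_mul]
  field_simp
  ring

theorem step_binOfRank (x : Fin n → ℕ) (r s : Fin n) :
    step x r (binOfRank x s) = x (binOfRank x s) + if s = r then 1 else 0 := by
  unfold step
  by_cases h : s = r
  · subst h; simp
  · rw [Function.update_of_ne ((binOfRank_injective x).ne h)]; simp [h]

theorem sum_step (x : Fin n → ℕ) (r : Fin n) : ∑ i, (step x r i : ℝ) = ∑ i, (x i : ℝ) + 1 := by
  rw [← sum_binOfRank x fun i => (step x r i : ℝ), ← sum_binOfRank x fun i => (x i : ℝ)]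
  simp [step_binOfRank, Finset.sum_add_distrib]

theorem excess_step (x : Fin n → ℕ) (r s : Fin n) :
    excess (step x r) (binOfRank x s) =
      excess x (binOfRank x s) + (if s = r then 1 else 0) - 1 / n := by
  unfold excess
  rw [sum_step, step_binOfRank]
  push_cast
  ring

theorem sum_rankProb_mul_exp [NeZero n] {d : ℝ} (hd : 1 < d) (a : ℝ) (x : Fin n → ℕ) :
    ∑ r, rankProb n d r * ∑ i, Real.exp (a * excess (step x r) i) =
      ∑ s, Real.exp (-(a * (1 / n))) * (1 + rankProb n d s * (Real.exp a - 1)) *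
        Real.exp (a * excess x (binOfRank x s)) := by
  have h1 : ∀ r, ∑ i, Real.exp (a * excess (step x r) i) =
      ∑ s, Real.exp (-(a * (1 / n))) * Real.exp (a * excess x (binOfRank x s)) *
        (1 + if s = r then Real.exp a - 1 else 0) := by
    intro r
    rw [← sum_binOfRank x]
    refine Finset.sum_congr rfl fun s _ => ?_
    rw [excess_step]
    by_cases h : s = r
    · simp only [h, if_true]
      rw [add_sub_cancel, ← Real.exp_add, ← Real.exp_add]; congr 1; ring
    · simp only [h, if_false]
      rw [add_zero, add_zero, mul_one, ← Real.exp_add]; congr 1; ring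
  simp only [h1, Finset.mul_sum]
  rw [Finset.sum_comm]
  refine Finset.sum_congr rfl fun s _ => ?_
  have h2 : ∑ r, rankProb n d r * (1 + if s = r then Real.exp a - 1 else 0) =
      1 + rankProb n d s * (Real.exp a - 1) := by
    simp only [mul_add, Finset.sum_add_distrib, mul_one, sum_rankProb_real hd]
    simp
  rw [← h2, Finset.mul_sum, Finset.sum_mul]
  exact Finset.sum_congr rfl fun r _ => by ring

theorem antitone_excess (x : Fin n → ℕ) : Antitone fun r => excess x (binOfRank x r) := by
  intro r s hrs
  have : (x (binOfRank x s) : ℝ) ≤ x (binOfRank x r) := by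
    exact_mod_cast antitone_binOfRank x hrs
  simp only [excess]
  linarith

theorem sum_mul_sinh_excess_le [NeZero n] {d a : ℝ} (hd : 1 < d) (ha : 0 < a) (x : Fin n → ℕ) :
    ∑ r, (rankProb n d r - 1 / n) * (2 * Real.sinh (a * excess x (binOfRank x r))) ≤
      -((1 - 2 * (1 / 2 : ℝ) ^ d) * (1 / n) / 3) * (potential a x - 2 * n) := by
  set z : Fin n → ℝ := fun r => a * excess x (binOfRank x r) with hz
  have hz0 : ∑ r, z r = 0 := by
    rw [hz, ← Finset.mul_sum, sum_binOfRank x (excess x), sum_excess, mul_zero]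
  have hza : Antitone z := fun r s hrs =>
    mul_le_mul_of_nonneg_left (antitone_excess x hrs) ha.le
  have hφ : Antitone fun r => Real.sinh (z r) := fun r s hrs => Real.sinh_le_sinh.mpr (hza hrs)
  have h1 := sum_halfSign_mul_le hd hφ
  have h2 := sum_abs_sinh_le hz0 hza
  have h3 : potential a x - 2 * n ≤ 2 * ∑ r, |Real.sinh (z r)| := by
    have : ∑ _r : Fin n, (2 : ℝ) = 2 * n := by simp [mul_comm]
    rw [potential, ← sum_binOfRank x, ← this, ← Finset.sum_sub_distrib, Finset.mul_sum]
    refine Finset.sum_le_sum fun r _ => ?_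
    rw [neg_mul]
    change Real.exp (z r) + Real.exp (-z r) - 2 ≤ 2 * |Real.sinh (z r)|
    rw [Real.sinh_eq, abs_div, abs_of_pos (by norm_num : (0 : ℝ) < 2)]
    rcases le_total 0 (z r) with h | h
    · have h4 : Real.exp (-z r) ≤ 1 := Real.exp_le_one_iff.mpr (by linarith)
      have := le_abs_self (Real.exp (z r) - Real.exp (-z r))
      linarith
    · have h4 : Real.exp (z r) ≤ 1 := Real.exp_le_one_iff.mpr h
      have := neg_le_abs (Real.exp (z r) - Real.exp (-z r))
      linarith
  have hc := (one_sub_two_mul_half_rpow_mem hd).1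
  set c := 1 - 2 * (1 / 2 : ℝ) ^ d
  have h5 : ∑ r, (rankProb n d r - 1 / n) * (2 * Real.sinh (z r)) =
      -(2 * ∑ r, (1 / n - rankProb n d r) * Real.sinh (z r)) := by
    rw [Finset.mul_sum, ← Finset.sum_neg_distrib]
    exact Finset.sum_congr rfl fun r _ => by ring
  rw [h5]
  have hcn : 0 ≤ c * (1 / n) := by positivity
  have h6 := mul_le_mul_of_nonneg_left (h3.trans (mul_le_mul_of_nonneg_left h2 zero_le_two)) hcn
  linarith

/-- The exponential potential contracts in expectation, up to an additive constant. -/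
theorem sum_rankProb_mul_potential_le [NeZero n] {d a : ℝ} (hd : 1 < d) (ha : 0 < a)
    (had : a ≤ (1 - 2 * (1 / 2 : ℝ) ^ d) / (60 * d ^ 2)) (x : Fin n → ℕ) :
    ∑ r, rankProb n d r * potential a (step x r) ≤
      (1 - a * (1 - 2 * (1 / 2 : ℝ) ^ d) / 6 * (1 / n)) * potential a x +
        2 * a * (1 - 2 * (1 / 2 : ℝ) ^ d) / 3 := by
  have hn : (1 : ℝ) ≤ n := by exact_mod_cast Nat.pos_of_ne_zero (NeZero.ne n)
  have hv0 : (0 : ℝ) ≤ 1 / n := by positivity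
  have hv1 : (1 : ℝ) / n ≤ 1 := by rw [div_le_one (by linarith)]; exact hn
  obtain ⟨hc0, hc1⟩ := one_sub_two_mul_half_rpow_mem hd
  have hsinh := sum_mul_sinh_excess_le hd ha x
  set c := 1 - 2 * (1 / 2 : ℝ) ^ d
  have had' : a * (60 * d ^ 2) ≤ c := by rwa [le_div_iff₀ (by positivity)] at had
  have ha1 : |a| * (2 * d + 1) ≤ 1 := by rw [abs_of_pos ha]; nlinarith
  have hG : ∑ s, (Real.exp (a * excess x (binOfRank x s)) +
      Real.exp (-a * excess x (binOfRank x s))) = potential a x :=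
    sum_binOfRank x fun i => Real.exp (a * excess x i) + Real.exp (-a * excess x i)
  have hG0 : 0 ≤ potential a x := Finset.sum_nonneg fun i _ => by positivity
  have h1 : ∑ r, rankProb n d r * potential a (step x r) ≤
      (1 + 10 * d ^ 2 * a ^ 2 * (1 / n)) * potential a x +
      a * ∑ r, (rankProb n d r - 1 / n) * (2 * Real.sinh (a * excess x (binOfRank x r))) := by
    simp only [potential, Finset.sum_add_distrib, mul_add]
    rw [sum_rankProb_mul_exp hd a, sum_rankProb_mul_exp hd (-a), ← Finset.sum_add_distrib,
      ← mul_add, ← Finset.sum_add_distrib]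
    change _ ≤ (1 + 10 * d ^ 2 * a ^ 2 * (1 / n)) * potential a x + _
    rw [← hG, Finset.mul_sum, Finset.mul_sum, ← Finset.sum_add_distrib]
    refine Finset.sum_le_sum fun s _ => ?_
    have e1 := exp_neg_mul_le hd.le ha1 hv0 hv1 (rankProb_nonneg hd s) (rankProb_le hd s)
    have e2 := exp_neg_mul_le (a := -a) hd.le (by rwa [abs_neg]) hv0 hv1 (rankProb_nonneg hd s)
      (rankProb_le hd s)
    have e3 := mul_le_mul_of_nonneg_right e1 (Real.exp_pos (a * excess x (binOfRank x s))).le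
    have e4 := mul_le_mul_of_nonneg_right e2 (Real.exp_pos (-a * excess x (binOfRank x s))).le
    refine (add_le_add e3 e4).trans (le_of_eq ?_)
    rw [Real.sinh_eq]
    simp only [neg_mul]
    ring
  have h2 := mul_le_mul_of_nonneg_left hsinh ha.le
  -- The constant 60 in `had` makes the second-order error at most half of the first-order gain `a c
  -- / (3 n)`.
  have h3 : 10 * d ^ 2 * a ^ 2 * (1 / n) * potential a x ≤
      a * c / 6 * (1 / n) * potential a x := by
    have : 10 * d ^ 2 * a ^ 2 ≤ a * c / 6 := by nlinarith
    gcongr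
  have h4 : a * (c * (1 / n) / 3 * (2 * n)) = 2 * a * c / 3 := by
    field_simp
  linarith

/-- `4 n` is the fixed point of the one-ball contraction, and the initial potential is `2 n`. -/
theorem expect_potential_le [NeZero n] {d a : ℝ} (hd : 1 < d) (ha : 0 < a)
    (had : a ≤ (1 - 2 * (1 / 2 : ℝ) ^ d) / (60 * d ^ 2)) (m : ℕ) :
    expect n d m (fun l => potential a (run 0 l)) ≤ 4 * n := by
  have hn : (1 : ℝ) ≤ n := by exact_mod_cast Nat.pos_of_ne_zero (NeZero.ne n)
  obtain ⟨hc0, hc1⟩ := one_sub_two_mul_half_rpow_mem hd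
  induction m with
  | zero =>
    simp [expect, run, potential, excess]
    linarith
  | succ m ih =>
    have h1 := expect_mono (n := n) hd m fun l => sum_rankProb_mul_potential_le hd ha had (run 0 l)
    rw [expect_add, expect_const_mul, expect_const hd] at h1
    refine h1.trans ?_
    set c := 1 - 2 * (1 / 2 : ℝ) ^ d
    have had' : a * (60 * d ^ 2) ≤ c := by rwa [le_div_iff₀ (by positivity)] at had
    have hac : a * c ≤ 1 := by nlinarith
    have h2 : 0 ≤ 1 - a * c / 6 * (1 / n) := by
      have : a * c / 6 * (1 / n) ≤ 1 * 1 := by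
        gcongr
        · linarith
        · rw [div_le_one (by linarith)]; exact hn
      linarith
    have h3 := mul_le_mul_of_nonneg_left ih h2
    have h4 : a * c / 6 * (1 / n) * (4 * n) = 2 * a * c / 3 := by field_simp; ring
    linarith

theorem sum_run_zero (l : List (Fin n)) : ∑ i, (run 0 l i : ℝ) = l.length := by
  induction l with
  | nil => simp [run]
  | cons r l ih => rw [run, sum_step, ih]; simp

/-- The length matters because `excess` and `normLoad` agree only after exactly `t * n` balls. -/
theorem expect_mono_of_length {d : ℝ} (hd : 1 < d) (m : ℕ) {f g : List (Fin n) → ℝ}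
    (h : ∀ l, l.length = m → f l ≤ g l) : expect n d m f ≤ expect n d m g := by
  induction m generalizing f g with
  | zero => exact h [] rfl
  | succ m ih =>
    exact ih fun l hl => Finset.sum_le_sum fun r _ =>
      mul_le_mul_of_nonneg_left (h _ (by simp [hl])) (rankProb_nonneg hd r)

theorem excess_eq_normLoad [NeZero n] {t : ℕ} {l : List (Fin n)} (hl : l.length = t * n)
    (i : Fin n) : excess (run 0 l) i = normLoad t (run 0 l) i := by
  have hn : (n : ℝ) ≠ 0 := Nat.cast_ne_zero.mpr (NeZero.ne n)
  rw [excess, normLoad, sum_run_zero, hl]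
  push_cast
  rw [mul_div_cancel_right₀ _ hn]

theorem exists_potentialBound {d : ℝ} (hd : 1 < d) : ∃ a b : ℝ, PotentialBound d hd a b := by
  have hc0 := (one_sub_two_mul_half_rpow_mem hd).1
  set a := (1 - 2 * (1 / 2 : ℝ) ^ d) / (60 * d ^ 2) with ha
  have ha0 : 0 < a := by positivity
  refine ⟨a, 4, ha0, fun n _ t => ?_⟩
  rw [lawAt, lintegral_loadLaw_ofReal hd (t * n)
    (fun x => Finset.sum_nonneg fun i _ => (Real.exp_pos _).le)]
  refine ENNReal.ofReal_le_ofReal ((expect_mono_of_length hd (t * n) fun l hl => ?_).trans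
    (expect_potential_le hd ha0 le_rfl (t * n)))
  refine Finset.sum_le_sum fun i _ => ?_
  rw [excess_eq_normLoad hl]
  rcases abs_cases (normLoad t (run 0 l) i) with ⟨h, -⟩ | ⟨h, -⟩ <;> rw [h]
  · linarith [Real.exp_pos (-a * normLoad t (run 0 l) i)]
  · rw [mul_neg, ← neg_mul]
    linarith [Real.exp_pos (a * normLoad t (run 0 l) i)]

/-- The potential bound forces `a` to be small, because the loads of the lightest bins grow at most
at the rate `d`. -/
theorem PotentialBound.le_mul_one_sub_exp {d : ℝ} {hd : 1 < d} {a b : ℝ}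
    (h : PotentialBound d hd a b) : a ≤ d * (1 - Real.exp (-a)) := by
  have ha := h.1
  have hb := h.one_le
  set κ := d * (1 - Real.exp (-a)) with hκ
  have hexp : Real.exp (-a) < 1 := Real.exp_lt_one_iff.mpr (by linarith)
  have hκ0 : 0 ≤ κ := mul_nonneg (by linarith) (by linarith)
  have key : ∀ n : ℕ, κ < n → Real.exp a * (1 + -κ / n) ^ n ≤ 1 := by
    intro n hn
    have hn0 : (0 : ℝ) < n := by linarith
    have : NeZero n := ⟨by rintro rfl; simp at hn0⟩
    have hq : 0 ≤ 1 + -κ / n := by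
      rw [neg_div, ← sub_eq_add_neg, sub_nonneg, div_le_one hn0]; exact hn.le
    -- No bin is hit with probability above `d / n`, so one ball shrinks the mean of this sum by a
    -- factor of at least `1 - κ / n`.
    have hstep : ∀ x : Fin n → ℕ, (1 + -κ / n) * ∑ i, Real.exp (-a * x i) ≤
        ∑ r, rankProb n d r * ∑ i, Real.exp (-a * (step x r i : ℕ)) := by
      intro x
      have h1 : ∀ r, ∑ i, Real.exp (-a * (step x r i : ℕ)) =
          ∑ i, Real.exp (-a * x i) -
            (1 - Real.exp (-a)) * Real.exp (-a * x (binOfRank x r)) := by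
        intro r
        rw [← sum_binOfRank x, ← sum_binOfRank x fun i => Real.exp (-a * x i)]
        have : (1 - Real.exp (-a)) * Real.exp (-a * x (binOfRank x r)) =
            ∑ s, if s = r then (1 - Real.exp (-a)) * Real.exp (-a * x (binOfRank x s)) else 0 := by
          simp
        rw [this, ← Finset.sum_sub_distrib]
        refine Finset.sum_congr rfl fun s _ => ?_
        rw [step_binOfRank]
        by_cases hs : s = r
        · simp only [hs, if_true]
          push_cast
          rw [mul_add, Real.exp_add]; ring_nf
        · simp [hs]
      simp only [h1, mul_sub, Finset.sum_sub_distrib, ← Finset.sum_mul, sum_rankProb_real hd,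
        one_mul]
      have h2 : ∑ r, rankProb n d r * ((1 - Real.exp (-a)) * Real.exp (-a * x (binOfRank x r))) ≤
          ∑ r, κ / n * Real.exp (-a * x (binOfRank x r)) := by
        refine Finset.sum_le_sum fun r _ => ?_
        rw [← mul_assoc]
        refine mul_le_mul_of_nonneg_right ?_ (Real.exp_pos _).le
        refine (mul_le_mul_of_nonneg_right (rankProb_le hd r) (by linarith)).trans (le_of_eq ?_)
        rw [hκ]; ring
      rw [← Finset.mul_sum, sum_binOfRank x fun i => Real.exp (-a * x i)] at h2
      rw [neg_div]
      linarith
    have hlow : ∀ m, n * (1 + -κ / n) ^ m ≤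
        expect n d m fun l => ∑ i, Real.exp (-a * (run 0 l i : ℕ)) := by
      intro m
      induction m with
      | zero => simp [expect, run]
      | succ m ih =>
        refine le_trans ?_ (expect_mono hd m fun l => hstep (run 0 l))
        rw [expect_const_mul, pow_succ]
        have := mul_le_mul_of_nonneg_left ih hq
        linarith
    have hbound : ∀ t : ℕ, (Real.exp a * (1 + -κ / n) ^ n) ^ t ≤ b := by
      intro t
      have h1 := h.expect_le (n := n) (by linarith) t
      have h2 : Real.exp (a * t) * (n * (1 + -κ / n) ^ (t * n)) ≤ b * n := by
        refine le_trans ?_ h1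
        refine (mul_le_mul_of_nonneg_left (hlow (t * n)) (Real.exp_pos _).le).trans ?_
        rw [← expect_const_mul]
        refine expect_mono hd _ fun l => ?_
        rw [Finset.mul_sum]
        refine Finset.sum_le_sum fun i _ => ?_
        rw [← Real.exp_add, Real.exp_le_exp]
        have := mul_le_mul_of_nonneg_left (neg_le_abs (normLoad t (run 0 l) i)) ha.le
        simp only [normLoad] at this ⊢
        linarith
      have h3 : (Real.exp a * (1 + -κ / n) ^ n) ^ t * n ≤ b * n := by
        refine le_trans (le_of_eq ?_) h2
        rw [mul_pow, ← pow_mul, ← Real.exp_nat_mul, mul_comm (t : ℝ) a, mul_comm n t]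
        ring
      exact le_of_mul_le_mul_right h3 hn0
    -- Powers bounded uniformly in `t` force the base to be at most 1.
    by_contra! hgt
    obtain ⟨t, ht⟩ := pow_unbounded_of_one_lt b hgt
    exact absurd (hbound t) (not_le.mpr ht)
  have hlim : Filter.Tendsto (fun n : ℕ => Real.exp a * (1 + -κ / n) ^ n) Filter.atTop
      (nhds (Real.exp a * Real.exp (-κ))) :=
    (Real.tendsto_one_add_div_pow_exp (-κ)).const_mul _
  have h1 : Real.exp a * Real.exp (-κ) ≤ 1 := by
    refine le_of_tendsto hlim ?_
    obtain ⟨N, hN⟩ := exists_nat_gt κ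
    filter_upwards [Filter.eventually_ge_atTop N] with n hn
    exact key n (hN.trans_le (by exact_mod_cast hn))
  rw [← Real.exp_add, Real.exp_le_one_iff] at h1
  linarith

/-- With `v = a / (5 (a + 1))`, one has `1 - exp (-a) ≤ a (1 - v) ≤ a exp (-v)`, so `a ≤ d (1 - exp
(-a))` gives `log d ≥ v`. -/
theorem PotentialBound.inv_log_le {d : ℝ} {hd : 1 < d} {a b : ℝ}
    (h : PotentialBound d hd a b) : 1 / Real.log d ≤ 5 + 5 / a := by
  have ha := h.1
  have hd0 : 0 < d := by linarith
  have h1 := h.le_mul_one_sub_exp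
  set v := a / (5 * (a + 1)) with hv
  have hva : v * (5 * (a + 1)) = a := by rw [hv]; field_simp
  have hv0 : 0 < v := by positivity
  have hv5 : v < 1 / 5 := by nlinarith
  have h2 : 1 - Real.exp (-a) ≤ a * (1 - v) := by
    -- For `a ≤ 2`, squaring `1 - a / 2 ≤ exp (-a / 2)` gives `1 - exp (-a) ≤ a (1 - a / 4)`. For `a
    -- ≥ 2`, already `a (1 - v) > 1`.
    rcases le_total a 2 with ha2 | ha2
    · have e1 : 1 - a / 2 ≤ Real.exp (-(a / 2)) := by
        linarith [Real.add_one_le_exp (-(a / 2))]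
      have e2 : Real.exp (-a) = Real.exp (-(a / 2)) ^ 2 := by
        rw [← Real.exp_nat_mul]; congr 1; push_cast; ring
      have e3 : (1 - a / 2) ^ 2 ≤ Real.exp (-(a / 2)) ^ 2 := by
        apply pow_le_pow_left₀ (by linarith) e1
      rw [e2]
      have : v ≤ a / 4 := by nlinarith
      nlinarith
    · have := Real.exp_pos (-a)
      nlinarith
  have h3 : 1 - v ≤ Real.exp (-v) := by linarith [Real.add_one_le_exp (-v)]
  have h4 : a ≤ d * (a * Real.exp (-v)) :=
    h1.trans (mul_le_mul_of_nonneg_left (h2.trans (mul_le_mul_of_nonneg_left h3 ha.le)) hd0.le)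
  have h5 : 1 ≤ d * Real.exp (-v) := by
    have : a * 1 ≤ a * (d * Real.exp (-v)) := by linarith
    exact le_of_mul_le_mul_left this ha
  have h6 : v ≤ Real.log d := by
    rw [Real.le_log_iff_exp_le hd0]
    have := mul_le_mul_of_nonneg_right h5 (Real.exp_pos v).le
    rw [mul_assoc, ← Real.exp_add] at this
    simpa using this
  calc 1 / Real.log d ≤ 1 / v := one_div_le_one_div_of_le hv0 h6
    _ = 5 + 5 / a := by rw [hv]; field_simp

end Potential
-- Solving the recursion for the levels
section Levels

theorem add_add_rpow_le {d x y z : ℝ} (hd : 0 ≤ d) (hx : 0 ≤ x) (hy : 0 ≤ y) (hz : 0 ≤ z) :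
    (x + y + z) ^ d ≤ 3 ^ d * (x ^ d + y ^ d + z ^ d) := by
  have hx' := Real.rpow_nonneg hx d
  have hy' := Real.rpow_nonneg hy d
  have hz' := Real.rpow_nonneg hz d
  have key : ∀ w, 0 ≤ w → x + y + z ≤ 3 * w → w ^ d ≤ x ^ d + y ^ d + z ^ d →
      (x + y + z) ^ d ≤ 3 ^ d * (x ^ d + y ^ d + z ^ d) := by
    intro w hw h1 h2
    calc _ ≤ (3 * w) ^ d := Real.rpow_le_rpow (by positivity) h1 hd
      _ = 3 ^ d * w ^ d := Real.mul_rpow (by norm_num) hw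
      _ ≤ _ := by gcongr
  rcases le_total x y with h | h <;> rcases le_total y z with h' | h' <;>
    rcases le_total x z with h'' | h''
  · exact key z hz (by linarith) (by linarith)
  · exact key z hz (by linarith) (by linarith)
  · exact key y hy (by linarith) (by linarith)
  · exact key y hy (by linarith) (by linarith)
  · exact key z hz (by linarith) (by linarith)
  · exact key x hx (by linarith) (by linarith)
  · exact key x hx (by linarith) (by linarith)
  · exact key x hx (by linarith) (by linarith)

/-- A bound for the fraction of the bins that are at level `i` after `s` rounds: a doubly
exponentially small stationary part, a part that remembers the initial loads and decays with `s`,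
and an error that accumulates. -/
noncomputable def levelBound (d a B W ε : ℝ) (i s : ℕ) : ℝ :=
  B * Real.exp (-(d ^ i / (d - 1))) + W * Real.exp (-(a * i)) * Real.exp (-(a / 2 * s)) + s * ε

/-- Up to the factor `3 ^ d` from `add_add_rpow_le`, each part reproduces itself. The `d`-th power
moves the stationary part exactly one level up, and small `B` absorbs the constant. The transient
part arrives from level `i + 2` with factor `exp (-3a/2)` where `exp (-a)` is allowed; decaying at
rate `a / 2` rather than `a` leaves this room. The last part gains one `ε` per round. -/
theorem levelBound_recursion {d a B W ε ε' : ℝ} (hd : 1 < d) (ha : 0 < a) (hB : 0 < B) (hW : 0 < W)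
    (hε : 0 ≤ ε) (hBd : 2 * 3 ^ d * B ^ (d - 1) ≤ 1 / 2)
    (hWd : 2 * 3 ^ d * W ^ (d - 1) ≤ Real.exp (-a) - Real.exp (-(3 / 2 * a))) (i s : ℕ)
    (hs : 2 * 3 ^ d * (((s + 1 : ℕ) : ℝ) * ε) ^ d + ε' ≤ ε) :
    2 * levelBound d a B W ε i (s + 1) ^ d + ε' + levelBound d a B W ε (i + 2) s ≤
      levelBound d a B W ε (i + 1) (s + 1) := by
  have hd0 : 0 < d := by linarith
  have hd1 : 0 < d - 1 := by linarith
  have hrpow : ∀ x : ℝ, 0 < x → x ^ d = x * x ^ (d - 1) := fun x hx => by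
    rw [Real.rpow_sub_one hx.ne']; field_simp
  set E := Real.exp (-(d ^ (i + 1) / (d - 1))) with hE
  have hE0 : 0 < E := Real.exp_pos _
  set w := W * Real.exp (-(a * i)) * Real.exp (-(a / 2 * ((s + 1 : ℕ) : ℝ))) with hw
  have hw0 : 0 < w := by positivity
  have hβ : (B * Real.exp (-(d ^ i / (d - 1)))) ^ d = B * B ^ (d - 1) * E := by
    rw [Real.mul_rpow hB.le (Real.exp_pos _).le, hrpow B hB, ← Real.exp_mul, hE]
    congr 2
    rw [pow_succ]; ring
  have hβ2 : B * Real.exp (-(d ^ (i + 2) / (d - 1))) ≤ B * E / 2 := by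
    -- The denominator `d - 1` is there so that going up one level gains `d ^ (i + 1) ≥ 1` in the
    -- exponent.
    have h1 : -(d ^ (i + 2) / (d - 1)) = -(d ^ (i + 1) / (d - 1)) + -(d ^ (i + 1)) := by
      field_simp; ring
    have h2 : (1 : ℝ) ≤ d ^ (i + 1) := one_le_pow₀ hd.le
    have h3 : Real.exp (-(d ^ (i + 1))) ≤ 1 / 2 := by
      rw [Real.exp_neg, one_div]
      apply inv_anti₀ (by norm_num)
      have := Real.add_one_le_exp (d ^ (i + 1))
      linarith
    rw [h1, Real.exp_add, ← hE]
    have := mul_le_mul_of_nonneg_left h3 (mul_pos hB hE0).le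
    linarith
  have hwW : w ≤ W := by
    have h1 : Real.exp (-(a * i)) ≤ 1 := Real.exp_le_one_iff.mpr (by
      have : 0 ≤ a * i := by positivity
      linarith)
    have h2 : Real.exp (-(a / 2 * ((s + 1 : ℕ) : ℝ))) ≤ 1 := Real.exp_le_one_iff.mpr (by
      have : 0 ≤ a / 2 * ((s + 1 : ℕ) : ℝ) := by positivity
      linarith)
    calc w ≤ W * 1 * 1 := by rw [hw]; gcongr
      _ = W := by ring
  have hwd : w ^ d ≤ w * W ^ (d - 1) := by
    rw [hrpow w hw0]
    gcongr
  have hw2 : W * Real.exp (-(a * ((i + 2 : ℕ) : ℝ))) * Real.exp (-(a / 2 * s)) =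
      w * Real.exp (-(3 / 2 * a)) := by
    rw [hw, mul_assoc, mul_assoc, mul_assoc, ← Real.exp_add, ← Real.exp_add, ← Real.exp_add]
    congr 2; push_cast; ring
  have hw1 : W * Real.exp (-(a * ((i + 1 : ℕ) : ℝ))) *
      Real.exp (-(a / 2 * ((s + 1 : ℕ) : ℝ))) = w * Real.exp (-a) := by
    rw [hw, mul_assoc, mul_assoc, mul_assoc, ← Real.exp_add, ← Real.exp_add, ← Real.exp_add]
    congr 2; push_cast; ring
  have h3 := add_add_rpow_le hd0.le (by positivity : 0 ≤ B * Real.exp (-(d ^ i / (d - 1)))) hw0.le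
    (by positivity : 0 ≤ ((s + 1 : ℕ) : ℝ) * ε)
  rw [hβ] at h3
  have h4 : 2 * 3 ^ d * (B * B ^ (d - 1) * E) ≤ B * E / 2 := by
    have := mul_le_mul_of_nonneg_right hBd (mul_pos hB hE0).le
    linarith
  have h5 : 2 * 3 ^ d * w ^ d ≤ w * (Real.exp (-a) - Real.exp (-(3 / 2 * a))) := by
    have e1 := mul_le_mul_of_nonneg_left hwd (by positivity : (0 : ℝ) ≤ 2 * 3 ^ d)
    have e2 := mul_le_mul_of_nonneg_left hWd hw0.le
    linarith
  unfold levelBound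
  rw [hw1, hw2]
  have h6 : (((s + 1 : ℕ) : ℝ)) * ε = s * ε + ε := by push_cast; ring
  rw [← hw]
  rw [← hE]
  linarith

theorem exists_small_rpow {d c e : ℝ} (hd : 1 < d) (hc : 0 < c) (he : 0 < e) :
    ∃ x : ℝ, 0 < x ∧ x ≤ e ∧ 2 * 3 ^ d * x ^ (d - 1) ≤ c := by
  have h3 : (0 : ℝ) < 2 * 3 ^ d := by positivity
  have hd1 : 0 < d - 1 := by linarith
  refine ⟨min e ((c / (2 * 3 ^ d)) ^ (1 / (d - 1))), by positivity, min_le_left _ _, ?_⟩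
  have h1 : min e ((c / (2 * 3 ^ d)) ^ (1 / (d - 1))) ^ (d - 1) ≤ c / (2 * 3 ^ d) := by
    calc _ ≤ ((c / (2 * 3 ^ d)) ^ (1 / (d - 1))) ^ (d - 1) :=
          Real.rpow_le_rpow (by positivity) (min_le_right _ _) hd1.le
      _ = c / (2 * 3 ^ d) := by
          rw [← Real.rpow_mul (by positivity), one_div_mul_cancel hd1.ne', Real.rpow_one]
  rw [le_div_iff₀ h3] at h1
  linarith

theorem numGE_mul_exp_le {n : ℕ} {a : ℝ} (ha : 0 < a) (x : Fin n → ℕ) (s j : ℕ) :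
    numGE x (s + j) * Real.exp (a * j) ≤ ∑ i, Real.exp (a * |normLoad s x i|) := by
  rw [numGE, ← nsmul_eq_mul]
  refine (Finset.card_nsmul_le_sum _ (fun i => Real.exp (a * |normLoad s x i|)) _ ?_).trans
    (Finset.sum_le_sum_of_subset_of_nonneg (Finset.filter_subset _ _)
      fun i _ _ => (Real.exp_pos _).le)
  intro i hi
  simp only [Finset.mem_filter, Finset.mem_univ, true_and] at hi
  rw [Real.exp_le_exp]
  have h1 : (s : ℝ) + j ≤ x i := by exact_mod_cast hi
  have h2 := le_abs_self (normLoad s x i)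
  simp only [normLoad] at h2 ⊢
  gcongr
  linarith

/-- If the potential is small in each of the last `M` rounds and the ranks behave, then no bin is
heavily loaded in the end. -/
theorem run_le_of_good {n : ℕ} (hn : 0 < n) (l : List (Fin n)) (T M h I K m : ℕ)
    {d a B W ε ε' : ℝ} (hd : 1 < d) (ha : 0 < a) (hB : 0 < B) (hW : 0 < W)
    (hε : 0 ≤ ε) (hBd : 2 * 3 ^ d * B ^ (d - 1) ≤ 1 / 2)
    (hWd : 2 * 3 ^ d * W ^ (d - 1) ≤ Real.exp (-a) - Real.exp (-(3 / 2 * a)))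
    (hWB : W ≤ B * Real.exp (-(1 / (d - 1))))
    (hM : 2 * 3 ^ d * ((M : ℝ) * ε) ^ d + ε' ≤ ε)
    (hK : levelBound d a B W ε I M * n < K + 1)
    (hpot : ∀ u ≤ M, ∑ i, Real.exp (a * |normLoad (T + (M - u)) (run 0 (l.drop (u * n))) i|) ≤
      W * Real.exp (a * h) * n)
    (hgap : ∀ i, run 0 (l.drop (M * n)) i < T + M)
    (hround : ∀ u < M, ∀ K ≤ n,
      (countLT K ((l.drop (u * n)).take n) : ℝ) ≤ (2 * ((K : ℝ) / n) ^ d + ε') * n)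
    (hwin : countLT K (l.take (M * n)) ≤ m) (i : Fin n) :
    run 0 l i ≤ T + M + h + I + m := by
  have hd0 : 0 < d := by linarith
  have hnum : ∀ u ≤ M, ∀ i : ℕ, (numGE (run 0 (l.drop (u * n))) (T + (M - u) + h + i) : ℝ) ≤
      W * Real.exp (-(a * i)) * n := by
    intro u hu i
    have h1 := (numGE_mul_exp_le ha (run 0 (l.drop (u * n))) (T + (M - u)) (h + i)).trans
      (hpot u hu)
    rw [← add_assoc] at h1
    have h2 := mul_le_mul_of_nonneg_right h1 (Real.exp_pos (-(a * ((h + i : ℕ) : ℝ)))).le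
    rw [mul_assoc, ← Real.exp_add, add_neg_cancel, Real.exp_zero, mul_one] at h2
    refine h2.trans (le_of_eq ?_)
    have : Real.exp (-(a * i)) = Real.exp (a * h) * Real.exp (-(a * ((h + i : ℕ) : ℝ))) := by
      rw [← Real.exp_add]; congr 1; push_cast; ring
    rw [this]; ring
  have hlevel := numGE_le_of_recursion l T M h hd0.le hn (levelBound d a B W ε)
    (ε := ε') ?_ ?_ hround ?_ M le_rfl I
  · rw [Nat.sub_self, zero_mul, List.drop_zero] at hlevel
    have h1 : numGE (run 0 l) (T + M + h + I) ≤ K := by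
      have : (numGE (run 0 l) (T + M + h + I) : ℝ) < K + 1 := hlevel.trans_lt hK
      have : numGE (run 0 l) (T + M + h + I) < K + 1 := by exact_mod_cast this
      omega
    have hrun : run 0 l = run (run 0 (l.drop (M * n))) (l.take (M * n)) := by
      rw [← run_append, List.take_append_drop]
    rw [hrun] at h1 ⊢
    have h2 := run_le_max_add _ _ _ _ h1 i
    have h3 := hgap i
    -- At the start of the window every bin is below `T + M`, hence below the level in question.
    rw [max_eq_right (by omega)] at h2
    omega
  · intro i
    have h1 := hnum M le_rfl i
    rw [Nat.sub_self, add_zero] at h1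
    refine h1.trans ?_
    gcongr
    have : 0 ≤ B * Real.exp (-(d ^ i / (d - 1))) := by positivity
    simp [levelBound]
    linarith
  · intro s hs
    have h1 := hnum (M - s) (by omega) 0
    rw [Nat.sub_sub_self hs, add_zero] at h1
    refine h1.trans ?_
    gcongr
    have h2 : 0 ≤ W * Real.exp (-(a * (0 : ℕ))) * Real.exp (-(a / 2 * s)) := by positivity
    have h3 : 0 ≤ s * ε := by positivity
    simp only [levelBound, pow_zero, CharP.cast_eq_zero, mul_zero, neg_zero, Real.exp_zero,
      mul_one] at h2 ⊢
    linarith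
  · intro i s hs
    refine levelBound_recursion hd ha hB hW hε hBd hWd i s (le_trans ?_ hM)
    have : ((s + 1 : ℕ) : ℝ) ≤ M := by exact_mod_cast hs
    gcongr

end Levels

/-! ### Probabilities of the bad events -/

section Tail

variable {n : ℕ} [NeZero n] {d a b : ℝ} {hd : 1 < d}

theorem indicator_one_le_div {α : Type*} {f : α → ℝ} (hf : ∀ x, 0 ≤ f x) {c : ℝ} (hc : 0 < c)
    (x : α) : ({x | c ≤ f x}.indicator 1 x : ℝ) ≤ c⁻¹ * f x := by
  refine Set.indicator_apply_le' (fun h => ?_) fun _ => mul_nonneg (inv_pos.mpr hc).le (hf x)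
  have : c ≤ f x := h
  rw [Pi.one_apply, inv_mul_eq_div, one_le_div hc]
  exact this

theorem PotentialBound.expect_indicator_le (h : PotentialBound d hd a b) {c : ℝ} (hc : 0 < c)
    (s u : ℕ) :
    expect n d ((s + u) * n) (fun l => {x : Fin n → ℕ |
      c ≤ ∑ i, Real.exp (a * |normLoad s x i|)}.indicator 1 (run 0 (l.drop (u * n)))) ≤
      c⁻¹ * (b * n) := by
  have hb := h.one_le
  rw [add_mul, expect_drop hd (s * n) (u * n) fun l => {x : Fin n → ℕ |
      c ≤ ∑ i, Real.exp (a * |normLoad s x i|)}.indicator 1 (run 0 l)]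
  refine (expect_mono hd _ fun l => indicator_one_le_div
    (fun x => Finset.sum_nonneg fun i _ => (Real.exp_pos _).le) hc (run 0 l)).trans ?_
  rw [expect_const_mul]
  exact mul_le_mul_of_nonneg_left (h.expect_le (by linarith) s) (inv_pos.mpr hc).le

/-- Chernoff with parameter 1; the factor 2 bounds `exp 1 - 1`. -/
theorem expect_indicator_round (hd : 1 < d) (s u : ℕ) {K : ℕ} (hK : K ≤ n) {ε : ℝ} :
    expect n d ((s + 1 + u) * n) (fun l => {l | (2 * ((K : ℝ) / n) ^ d + ε) * n ≤
      (countLT K l : ℝ)}.indicator 1 ((l.drop (u * n)).take n)) ≤ Real.exp (-(ε * n)) := by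
  rw [add_mul, expect_drop hd ((s + 1) * n) (u * n) fun l =>
    {l | (2 * ((K : ℝ) / n) ^ d + ε) * n ≤ (countLT K l : ℝ)}.indicator 1 (l.take n),
    add_mul, one_mul, expect_take hd (s * n) n]
  refine (expect_indicator_countP hd n hK zero_le_one _).trans (Real.exp_le_exp.mpr ?_)
  have h1 : Real.exp 1 - 1 ≤ 2 := by linarith [Real.exp_one_lt_d9]
  have h2 : (0 : ℝ) ≤ n * ((K : ℝ) / n) ^ d := by positivity
  nlinarith

end Tail
-- Tail bounds for the gap
section Tail

variable {n : ℕ} [NeZero n] {d a b : ℝ} {hd : 1 < d}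

theorem exists_gap_eq_normLoad (t : ℕ) (x : Fin n → ℕ) : ∃ i, gap t x = normLoad t x i := by
  obtain ⟨i, -, hi⟩ := Finset.exists_mem_eq_sup Finset.univ Finset.univ_nonempty x
  exact ⟨i, by rw [gap, normLoad, hi]⟩

/-- Plain Markov, since the fullest bin alone contributes `exp (a y)`. It serves the finitely many
small `n`. -/
theorem PotentialBound.gap_tail_le (h : PotentialBound d hd a b) (t : ℕ) (y : ℝ) :
    (lawAt n d hd t).real {x | y ≤ gap t x} ≤ Real.exp (-(a * y)) * (b * n) := by
  have ha := h.1
  rw [lawAt_real_eq_expect]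
  have h1 := h.expect_indicator_le (n := n) (Real.exp_pos (a * y)) t 0
  simp only [add_zero, zero_mul, List.drop_zero] at h1
  rw [Real.exp_neg]
  refine (expect_mono hd _ fun l => ?_).trans h1
  refine Set.indicator_le_indicator_of_subset ?_ (fun _ => zero_le_one) _
  intro x hx
  obtain ⟨i, hi⟩ := exists_gap_eq_normLoad t x
  have hx' : y ≤ gap t x := hx
  refine le_trans ?_ (Finset.single_le_sum
    (f := fun i => Real.exp (a * |normLoad t x i|)) (fun i _ => (Real.exp_pos _).le)
    (Finset.mem_univ i))
  rw [Real.exp_le_exp]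
  have := le_abs_self (normLoad t x i)
  gcongr
  linarith

/-- A union bound over the failures of the hypotheses of `run_le_of_good`: a large potential (`A`),
a bin too high at the start of the window (`G`), too many small ranks in a round (`Z`) or in the
whole window (`V`). `Z` runs over every `K ≤ n` because the number of heavy bins is random and
depends on the same balls. -/
theorem PotentialBound.gap_tail_le_of_good (hp : PotentialBound d hd a b) (T M h I K m : ℕ)
    {B W ε ε' c y : ℝ} (hB : 0 < B) (hW : 0 < W)
    (hε : 0 ≤ ε) (hBd : 2 * 3 ^ d * B ^ (d - 1) ≤ 1 / 2)
    (hWd : 2 * 3 ^ d * W ^ (d - 1) ≤ Real.exp (-a) - Real.exp (-(3 / 2 * a)))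
    (hWB : W ≤ B * Real.exp (-(1 / (d - 1))))
    (hM : 2 * 3 ^ d * ((M : ℝ) * ε) ^ d + ε' ≤ ε)
    (hK : levelBound d a B W ε I M * n < K + 1) (hKn : K ≤ n) (hc : 0 ≤ c)
    (hy : (h : ℝ) + I + m < y) :
    (lawAt n d hd (T + M)).real {x | y ≤ gap (T + M) x} ≤
      (M + 1) * ((W * Real.exp (a * h) * n)⁻¹ * (b * n)) +
      (Real.exp (a * M))⁻¹ * (b * n) + M * ((n + 1) * Real.exp (-(ε' * n))) +
      Real.exp (((M * n : ℕ) : ℝ) * ((K : ℝ) / n) ^ d * (Real.exp c - 1) -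
        c * ((m + 1 : ℕ) : ℝ)) := by
  have ha := hp.1
  have hn : 0 < n := Nat.pos_of_ne_zero (NeZero.ne n)
  have hn' : (0 : ℝ) < n := by exact_mod_cast hn
  set A : ℕ → List (Fin n) → ℝ := fun u l => {x : Fin n → ℕ | W * Real.exp (a * h) * n ≤
    ∑ i, Real.exp (a * |normLoad (T + (M - u)) x i|)}.indicator 1 (run 0 (l.drop (u * n))) with hA
  set G : List (Fin n) → ℝ := fun l => {x : Fin n → ℕ | Real.exp (a * M) ≤
    ∑ i, Real.exp (a * |normLoad T x i|)}.indicator 1 (run 0 (l.drop (M * n))) with hG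
  set Z : ℕ → ℕ → List (Fin n) → ℝ := fun u K l => {l | (2 * ((K : ℝ) / n) ^ d + ε') * n ≤
      (countLT K l : ℝ)}.indicator 1 ((l.drop (u * n)).take n) with hZ
  set V : List (Fin n) → ℝ := fun l =>
    {l | ((m + 1 : ℕ) : ℝ) ≤ (countLT K l : ℝ)}.indicator 1 (l.take (M * n)) with hV
  have hA0 : ∀ u l, 0 ≤ A u l := fun u l => Set.indicator_nonneg (fun _ _ => zero_le_one) _
  have hG0 : ∀ l, 0 ≤ G l := fun l => Set.indicator_nonneg (fun _ _ => zero_le_one) _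
  have hZ0 : ∀ u K l, 0 ≤ Z u K l := fun u K l => Set.indicator_nonneg (fun _ _ => zero_le_one) _
  have hV0 : ∀ l, 0 ≤ V l := fun l => Set.indicator_nonneg (fun _ _ => zero_le_one) _
  have hZs0 : ∀ u l, 0 ≤ ∑ K ∈ Finset.range (n + 1), Z u K l := fun u l =>
    Finset.sum_nonneg fun K _ => hZ0 u K l
  have hpoint : ∀ l : List (Fin n), ({x : Fin n → ℕ | y ≤ gap (T + M) x}.indicator 1 (run 0 l) : ℝ) ≤
      ∑ u ∈ Finset.range (M + 1), A u l + G l +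
        ∑ u ∈ Finset.range M, ∑ K ∈ Finset.range (n + 1), Z u K l + V l := by
    intro l
    have hAs : 0 ≤ ∑ u ∈ Finset.range (M + 1), A u l := Finset.sum_nonneg fun u _ => hA0 u l
    have hZs : 0 ≤ ∑ u ∈ Finset.range M, ∑ K ∈ Finset.range (n + 1), Z u K l :=
      Finset.sum_nonneg fun u _ => hZs0 u l
    have hGl := hG0 l
    have hVl := hV0 l
    refine Set.indicator_apply_le' (fun hl => ?_) fun _ => by positivity
    rw [Pi.one_apply]
    -- If the sum of the indicators is below 1, none of the bad events occurs.
    by_contra! hlt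
    have hgood := run_le_of_good hn l T M h I K m hd ha hB hW hε hBd hWd hWB hM hK ?_ ?_ ?_ ?_
    · obtain ⟨i, hi⟩ := exists_gap_eq_normLoad (T + M) (run 0 l)
      have h1 : y ≤ gap (T + M) (run 0 l) := hl
      have h2 : (run 0 l i : ℝ) ≤ T + M + h + I + m := by exact_mod_cast hgood i
      rw [hi, normLoad] at h1
      push_cast at h1
      linarith
    · intro u hu
      by_contra! hbad
      have h1 : A u l = 1 := Set.indicator_of_mem (by exact hbad.le) _
      have h2 := Finset.single_le_sum (f := fun u => A u l) (fun u _ => hA0 u l)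
        (Finset.mem_range.mpr (Nat.lt_succ_of_le hu))
      simp only [h1] at h2
      linarith
    · intro i
      by_contra! hbad
      have h1 : G l = 1 := by
        refine Set.indicator_of_mem ?_ _
        refine le_trans ?_ (numGE_mul_exp_le ha _ T M)
        have h2 : 1 ≤ numGE (run 0 (l.drop (M * n))) (T + M) :=
          Finset.card_pos.mpr ⟨i, by simpa using hbad⟩
        have h3 : (1 : ℝ) ≤ numGE (run 0 (l.drop (M * n))) (T + M) := by exact_mod_cast h2
        have := Real.exp_pos (a * M)
        nlinarith
      linarith
    · intro u hu K hK
      by_contra! hbad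
      have h1 : Z u K l = 1 := Set.indicator_of_mem (by exact hbad.le) _
      have h2 := Finset.single_le_sum (f := fun K => Z u K l) (fun K _ => hZ0 u K l)
        (Finset.mem_range.mpr (Nat.lt_succ_of_le hK))
      have h3 := Finset.single_le_sum (f := fun u => ∑ K ∈ Finset.range (n + 1), Z u K l)
        (fun u _ => hZs0 u l) (Finset.mem_range.mpr hu)
      simp only [h1] at h2
      linarith
    · by_contra! hbad
      have h1 : V l = 1 := Set.indicator_of_mem (by
        have : m + 1 ≤ countLT K (l.take (M * n)) := hbad
        simpa using (by exact_mod_cast this : ((m + 1 : ℕ) : ℝ) ≤ countLT K (l.take (M * n)))) _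
      linarith
  rw [lawAt_real_eq_expect]
  refine (expect_mono hd _ hpoint).trans ?_
  rw [expect_add, expect_add, expect_add, expect_sum, expect_sum]
  have eA : ∀ u ∈ Finset.range (M + 1), expect n d ((T + M) * n) (A u) ≤
      (W * Real.exp (a * h) * n)⁻¹ * (b * n) := by
    intro u hu
    have hu' : u ≤ M := Nat.lt_succ_iff.mp (Finset.mem_range.mp hu)
    have := hp.expect_indicator_le (n := n) (c := W * Real.exp (a * h) * n) (by positivity)
      (T + (M - u)) u
    rwa [show T + (M - u) + u = T + M by omega] at this
  have eG : expect n d ((T + M) * n) G ≤ (Real.exp (a * M))⁻¹ * (b * n) :=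
    hp.expect_indicator_le (Real.exp_pos _) T M
  have eZ : ∀ u ∈ Finset.range M, expect n d ((T + M) * n)
      (fun l => ∑ K ∈ Finset.range (n + 1), Z u K l) ≤ (n + 1) * Real.exp (-(ε' * n)) := by
    intro u hu
    rw [expect_sum]
    have h1 : ∀ K ∈ Finset.range (n + 1), expect n d ((T + M) * n) (Z u K) ≤
        Real.exp (-(ε' * n)) := by
      intro K hK
      have := expect_indicator_round (n := n) hd (T + (M - u - 1)) u
        (Nat.lt_succ_iff.mp (Finset.mem_range.mp hK)) (ε := ε')
      rw [Finset.mem_range] at hu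
      rwa [show T + (M - u - 1) + 1 + u = T + M by omega] at this
    simpa using Finset.sum_le_card_nsmul _ _ _ h1
  have eV : expect n d ((T + M) * n) V ≤
      Real.exp (((M * n : ℕ) : ℝ) * ((K : ℝ) / n) ^ d * (Real.exp c - 1) -
        c * ((m + 1 : ℕ) : ℝ)) := by
    rw [add_mul]
    have h1 := expect_take (n := n) hd (T * n) (M * n)
      ({l | ((m + 1 : ℕ) : ℝ) ≤ (countLT K l : ℝ)}.indicator 1)
    rw [hV, h1]
    exact expect_indicator_countP hd (M * n) hKn hc _
  have sA := Finset.sum_le_card_nsmul _ _ _ eA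
  have sZ := Finset.sum_le_card_nsmul _ _ _ eZ
  rw [Finset.card_range, nsmul_eq_mul] at sA sZ
  push_cast at sA
  linarith

end Tail

/-! ### Choice of parameters -/

theorem eventually_large {d a b δ : ℝ} (hδ : 0 < δ) :
    ∃ N : ℕ, 3 ≤ N ∧ ∀ n : ℕ, N ≤ n →
      1 ≤ Real.log n ∧ (3 : ℝ) ^ d ≤ 7 * Real.log n ∧ b + 5 ≤ n ∧
      2 + 28 * (12 * Real.log n / a + 1) * Real.log n ≤ (n : ℝ) ^ δ := by
  have hlog : Filter.Tendsto (fun n : ℕ => Real.log n) Filter.atTop Filter.atTop :=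
    Real.tendsto_log_atTop.comp tendsto_natCast_atTop_atTop
  have hexp : Filter.Tendsto (fun n : ℕ =>
      (2 + 28 * Real.log n + 336 / a * Real.log n ^ 2) / Real.exp (δ * Real.log n))
      Filter.atTop (nhds 0) := by
    have h0 : ∀ k : ℕ, Filter.Tendsto (fun x : ℝ => x ^ k / Real.exp (δ * x)) Filter.atTop
        (nhds 0) := by
      intro k
      have := Real.tendsto_pow_mul_exp_neg_atTop_nhds_zero k
      have h2 := (this.comp (Filter.tendsto_id.const_mul_atTop hδ)).const_mul ((δ ^ k)⁻¹)
      rw [mul_zero] at h2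
      refine h2.congr fun x => ?_
      simp only [Function.comp, id, mul_pow, Real.exp_neg]
      field_simp
    have h1 := (((h0 0).const_mul 2).add ((h0 1).const_mul 28)).add ((h0 2).const_mul (336 / a))
    simp only [mul_zero, add_zero] at h1
    refine (h1.comp hlog).congr fun n => ?_
    simp only [Function.comp]
    ring
  have hev := ((hlog.eventually_ge_atTop 1).and ((hlog.eventually_ge_atTop (3 ^ d / 7)).and
    ((tendsto_natCast_atTop_atTop.eventually_ge_atTop (b + 5)).and
      ((hexp.eventually (gt_mem_nhds one_pos)).and (Filter.eventually_ge_atTop 3)))))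
  obtain ⟨N, hN⟩ := Filter.eventually_atTop.mp hev
  refine ⟨max N 3, le_max_right _ _, fun n hn => ?_⟩
  obtain ⟨h1, h2, h3, h4, h5⟩ := hN n ((le_max_left _ _).trans hn)
  refine ⟨h1, by linarith, h3, ?_⟩
  rw [div_lt_one (Real.exp_pos _)] at h4
  rw [Real.rpow_def_of_pos (by positivity), mul_comm (Real.log (n : ℝ)) δ]
  refine le_trans (le_of_eq ?_) h4.le
  ring

theorem PotentialBound.gap_tail_of_large {d a b : ℝ} {hd : 1 < d} (hp : PotentialBound d hd a b) :
    ∃ (γ : ℝ) (N : ℕ), ∀ (n : ℕ) [NeZero n], N ≤ n → ∀ k : ℝ, 0 ≤ k → ∀ t : ℕ,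
      12 * Real.log n / a ≤ t → ∀ y : ℝ, (5 + 10 / a) * Real.log (Real.log n) + k + γ ≤ y →
      (lawAt n d hd t).real {x | y ≤ gap t x} ≤
        1 / (n : ℝ) ^ 10 + Real.exp (-(a * k)) / Real.log n ^ 4 := by
  have ha := hp.1
  have hb := hp.one_le
  have hd0 : 0 < d := by linarith
  have hd1 : 0 < d - 1 := by linarith
  have hlogd : 0 < Real.log d := Real.log_pos hd
  obtain ⟨B, hB, hB1, hBd⟩ := exists_small_rpow hd (by norm_num : (0 : ℝ) < 1 / 2) one_pos
  obtain ⟨W, hW, hWB, hWd⟩ := exists_small_rpow hd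
    (c := Real.exp (-a) - Real.exp (-(3 / 2 * a)))
    (sub_pos.mpr (Real.exp_lt_exp.mpr (by linarith)))
    (mul_pos hB (Real.exp_pos (-(1 / (d - 1)))))
  have hW1 : W ≤ 1 := by
    have h1 : Real.exp (-(1 / (d - 1))) ≤ 1 := Real.exp_le_one_iff.mpr (by
      have : 0 < 1 / (d - 1) := by positivity
      linarith)
    calc W ≤ 1 * 1 := hWB.trans (by gcongr)
      _ = 1 := one_mul 1
  -- Chosen so that `δ + 1 + (δ - 1) d + (d - 1) / 2 = 0`, the exponent of `n` in the final Chernoff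
  -- bound; it also gives `(δ - 1) d ≤ -1`.
  set δ := (d - 1) / (2 * (d + 1)) with hδdef
  have hδ0 : 0 < δ := by positivity
  have hδ : δ * (2 * (d + 1)) = d - 1 := by rw [hδdef]; field_simp
  have hδ1 : δ ≤ 1 := by rw [hδdef, div_le_one (by positivity)]; linarith
  clear_value δ
  set m := ⌈24 / (d - 1)⌉₊ with hm
  have hm24 : 24 ≤ m * (d - 1) := by
    have := Nat.le_ceil (24 / (d - 1))
    rwa [div_le_iff₀ hd1] at this
  set C := (12 / a + 2) * b / W with hC
  have hC0 : 0 < C := by positivity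
  set c₁ := max (Real.log C) 0 with hc₁
  clear_value m
  obtain ⟨N, hN3, hN⟩ := eventually_large (d := d) (a := a) (b := b) hδ0
  -- Rounding up costs 1 in `h` and 2 in `I`; the remaining 1 makes `hymain` strict.
  refine ⟨c₁ / a + m + 4, N, fun n _ hn k hk t ht y hy => ?_⟩
  obtain ⟨hL1, hL3, hbn, hpoly⟩ := hN n hn
  have hn3 : 3 ≤ n := hN3.trans hn
  have hn0 : (0 : ℝ) < n := by positivity
  have hn1 : (1 : ℝ) ≤ n := by linarith
  set L := Real.log n with hL
  clear_value L
  have hL0 : 0 < L := by linarith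
  have hexpL : Real.exp L = n := by rw [hL, Real.exp_log hn0]
  set LL := Real.log L with hLL
  have hLL0 : 0 ≤ LL := Real.log_nonneg hL1
  have hexpLL : Real.exp LL = L := Real.exp_log hL0
  clear_value LL
  set M := ⌈12 * L / a⌉₊ with hMdef
  have hMt : M ≤ t := Nat.ceil_le.mpr ht
  have hMge : 12 * L / a ≤ M := Nat.le_ceil _
  have hMle : (M : ℝ) ≤ 12 * L / a + 1 := (Nat.ceil_lt_add_one (by positivity)).le
  clear_value M
  have haM : 12 * L ≤ a * M := by
    rw [div_le_iff₀ ha] at hMge; linarith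
  have hMpoly : 2 + M * (28 * L) ≤ (n : ℝ) ^ δ := by
    refine le_trans ?_ hpoly
    have := mul_le_mul_of_nonneg_right hMle (by positivity : 0 ≤ 28 * L)
    linarith
  have hMδ : (M : ℝ) ≤ (n : ℝ) ^ δ := by
    have : (M : ℝ) * 1 ≤ M * (28 * L) := by gcongr; linarith
    linarith
  have hnδ : (n : ℝ) ^ δ ≤ n := by
    simpa using Real.rpow_le_rpow_of_exponent_le hn1 hδ1
  -- The union over `M + 1 = O(L)` times costs one of the five factors `1 / L`; four remain in the
  -- bound.
  set h := ⌈(5 * LL + a * k + c₁) / a⌉₊ with hh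
  have hc₁0 : 0 ≤ c₁ := le_max_right _ _
  have hhge : 5 * LL + a * k + c₁ ≤ a * h := by
    have := Nat.le_ceil ((5 * LL + a * k + c₁) / a)
    rw [div_le_iff₀ ha] at this
    linarith
  have hhle : (h : ℝ) ≤ 5 / a * LL + k + c₁ / a + 1 := by
    refine (Nat.ceil_lt_add_one (by positivity)).le.trans (le_of_eq ?_)
    field_simp
  clear_value h
  set I := ⌈(LL + Real.log d) / Real.log d⌉₊ with hI
  have hIge : LL + Real.log d ≤ I * Real.log d := by
    have := Nat.le_ceil ((LL + Real.log d) / Real.log d)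
    rwa [div_le_iff₀ hlogd] at this
  have hIle : (I : ℝ) ≤ 1 / Real.log d * LL + 2 := by
    refine (Nat.ceil_lt_add_one (by positivity)).le.trans (le_of_eq ?_)
    field_simp
    ring
  clear_value I
  have hIL : L ≤ d ^ I / (d - 1) := by
    rw [le_div_iff₀ hd1]
    have h1 : Real.exp (LL + Real.log d) ≤ Real.exp (I * Real.log d) := Real.exp_le_exp.mpr hIge
    rw [Real.exp_add, hexpLL, Real.exp_log hd0, Real.exp_nat_mul, Real.exp_log hd0] at h1
    linarith
  set K := ⌊(n : ℝ) ^ δ⌋₊ with hK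
  have hKδ : (K : ℝ) ≤ (n : ℝ) ^ δ := Nat.floor_le (by positivity)
  have hKlt : (n : ℝ) ^ δ < K + 1 := Nat.lt_floor_add_one _
  clear_value K
  have hKn : K ≤ n := by exact_mod_cast hKδ.trans hnδ
  have hεn : 28 * L / n * n = 28 * L := by field_simp
  have hlevel : levelBound d a B W (28 * L / n) I M * n < K + 1 := by
    refine lt_of_le_of_lt (le_trans ?_ hMpoly) hKlt
    have e1 : Real.exp (-(d ^ I / (d - 1))) * n ≤ 1 := by
      rw [← hexpL, ← Real.exp_add]
      exact Real.exp_le_one_iff.mpr (by linarith)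
    have e2 : Real.exp (-(a / 2 * M)) * n ≤ 1 := by
      rw [← hexpL, ← Real.exp_add]
      exact Real.exp_le_one_iff.mpr (by linarith)
    have e3 : Real.exp (-(a * I)) ≤ 1 := Real.exp_le_one_iff.mpr (by
      have : 0 ≤ a * I := by positivity
      linarith)
    have e4 : B * (Real.exp (-(d ^ I / (d - 1))) * n) ≤ 1 * 1 := by gcongr
    have e5 : W * Real.exp (-(a * I)) * (Real.exp (-(a / 2 * M)) * n) ≤ 1 * 1 * 1 := by gcongr
    have e6 : (M : ℝ) * (28 * L / n) * n = M * (28 * L) := by rw [mul_assoc, hεn]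
    unfold levelBound
    linarith
  -- Half of `ε = 28 L / n` pays for the sampling error `ε' = 14 L / n`, whose failure probability
  -- is `n ^ (-14)`; the other half absorbs the `d`-th power of the accumulated error.
  have hMε : 2 * 3 ^ d * ((M : ℝ) * (28 * L / n)) ^ d + 14 * L / n ≤ 28 * L / n := by
    have e1 : (M : ℝ) * (28 * L / n) ≤ (n : ℝ) ^ (δ - 1) := by
      rw [Real.rpow_sub_one hn0.ne', ← mul_div_assoc]
      gcongr
      linarith
    have e2 : ((M : ℝ) * (28 * L / n)) ^ d ≤ (n : ℝ)⁻¹ := by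
      calc _ ≤ ((n : ℝ) ^ (δ - 1)) ^ d := Real.rpow_le_rpow (by positivity) e1 hd0.le
        _ = (n : ℝ) ^ ((δ - 1) * d) := (Real.rpow_mul hn0.le _ _).symm
        _ ≤ (n : ℝ) ^ (-1 : ℝ) := Real.rpow_le_rpow_of_exponent_le hn1 (by linarith)
        _ = (n : ℝ)⁻¹ := Real.rpow_neg_one _
    have e3 : 2 * 3 ^ d * ((M : ℝ) * (28 * L / n)) ^ d ≤ 14 * L * (n : ℝ)⁻¹ :=
      mul_le_mul (by linarith) e2 (by positivity) (by positivity)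
    have e4 : 14 * L / (n : ℝ) + 14 * L / n = 28 * L / n := by ring
    rw [← div_eq_mul_inv] at e3
    linarith
  set c := (d - 1) / 2 * L with hc
  have hc0 : 0 ≤ c := by positivity
  clear_value c
  -- `h` contributes `5 / a` and `I` contributes `1 / log d ≤ 5 + 5 / a` to the coefficient of `log
  -- log n`.
  have hymain : (h : ℝ) + I + m < y := by
    have h1 := mul_le_mul_of_nonneg_right hp.inv_log_le hLL0
    have h2 : (5 + 5 / a) * LL + 5 / a * LL = (5 + 10 / a) * LL := by ring
    linarith
  have hmain := hp.gap_tail_le_of_good (n := n) (t - M) M h I K m hB hW (by positivity) hBd hWd hWB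
    hMε hlevel hKn hc0 hymain
  rw [Nat.sub_add_cancel hMt] at hmain
  refine hmain.trans ?_
  have t1 : ((M : ℝ) + 1) * ((W * Real.exp (a * h) * n)⁻¹ * (b * n)) ≤
      Real.exp (-(a * k)) / L ^ 4 := by
    have e1 : L ^ 5 * Real.exp (a * k) * C ≤ Real.exp (a * h) := by
      have : L ^ 5 * Real.exp (a * k) * C = Real.exp (5 * LL + a * k + Real.log C) := by
        rw [Real.exp_add, Real.exp_add, Real.exp_log hC0]
        congr 2
        rw [show (5 : ℝ) * LL = ((5 : ℕ) : ℝ) * LL by norm_num, Real.exp_nat_mul, hexpLL]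
      rw [this, Real.exp_le_exp]
      linarith [le_max_left (Real.log C) 0]
    have e2 : (M : ℝ) + 1 ≤ (12 / a + 2) * L := by
      have : 12 * L / a = 12 / a * L := by ring
      linarith
    calc _ = ((M : ℝ) + 1) * (b / W) * (Real.exp (a * h))⁻¹ := by field_simp
      _ ≤ ((12 / a + 2) * L) * (b / W) * (L ^ 5 * Real.exp (a * k) * C)⁻¹ := by gcongr
      _ = Real.exp (-(a * k)) / L ^ 4 := by
        rw [Real.exp_neg, hC]; field_simp
  have hpow : ∀ j : ℕ, Real.exp (-(j * L)) = 1 / (n : ℝ) ^ j := by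
    intro j
    rw [Real.exp_neg, Real.exp_nat_mul, hexpL, one_div]
  have t2 : (Real.exp (a * M))⁻¹ * (b * n) ≤ b / (n : ℝ) ^ 11 := by
    have e1 : (Real.exp (a * M))⁻¹ ≤ 1 / (n : ℝ) ^ 12 := by
      rw [← Real.exp_neg, ← hpow, Real.exp_le_exp]
      push_cast
      linarith
    calc _ ≤ 1 / (n : ℝ) ^ 12 * (b * n) := by gcongr
      _ = _ := by field_simp
  have t3 : (M : ℝ) * ((n + 1) * Real.exp (-(14 * L / n * n))) ≤ 2 / (n : ℝ) ^ 11 := by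
    have e1 : Real.exp (-(14 * L / n * n)) = 1 / (n : ℝ) ^ 14 := by
      rw [← hpow]; congr 1; push_cast; field_simp
    rw [e1]
    calc _ ≤ (n : ℝ) * ((n + n) * (1 / (n : ℝ) ^ 14)) := by
          gcongr; exact_mod_cast hMδ.trans hnδ
      _ = 2 / (n : ℝ) ^ 12 := by field_simp; ring
      _ ≤ 2 / (n : ℝ) ^ 11 := by gcongr; norm_num
  have t4 : Real.exp (((M * n : ℕ) : ℝ) * ((K : ℝ) / n) ^ d * (Real.exp c - 1) -
      c * ((m + 1 : ℕ) : ℝ)) ≤ 3 / (n : ℝ) ^ 11 := by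
    have e1 : ((M * n : ℕ) : ℝ) * ((K : ℝ) / n) ^ d * (Real.exp c - 1) ≤ 1 := by
      have f1 : Real.exp c = (n : ℝ) ^ ((d - 1) / 2) := by
        rw [Real.rpow_def_of_pos hn0, hc, hL, mul_comm]
      have f2 : ((K : ℝ) / n) ^ d ≤ (n : ℝ) ^ ((δ - 1) * d) := by
        rw [Real.rpow_mul hn0.le, Real.rpow_sub_one hn0.ne']
        gcongr
      push_cast
      calc _ ≤ ((M : ℝ) * n) * ((K : ℝ) / n) ^ d * Real.exp c := by gcongr; linarith
        _ ≤ ((n : ℝ) ^ δ * n) * (n : ℝ) ^ ((δ - 1) * d) * (n : ℝ) ^ ((d - 1) / 2) := by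
          rw [f1]; gcongr
        _ = (n : ℝ) ^ (δ + 1 + (δ - 1) * d + (d - 1) / 2) := by
          rw [Real.rpow_add hn0, Real.rpow_add hn0, Real.rpow_add hn0, Real.rpow_one]
        _ = 1 := by
          have : δ + 1 + (δ - 1) * d + (d - 1) / 2 = 0 := by linarith
          rw [this, Real.rpow_zero]
    have e2 : ((11 : ℕ) : ℝ) * L ≤ c * ((m + 1 : ℕ) : ℝ) := by
      have : 24 * L ≤ m * (d - 1) * L := by gcongr
      rw [hc]; push_cast
      linarith
    calc _ ≤ Real.exp (1 + -(((11 : ℕ) : ℝ) * L)) := by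
          rw [Real.exp_le_exp, sub_eq_add_neg]
          exact add_le_add e1 (neg_le_neg e2)
      _ = Real.exp 1 * (1 / (n : ℝ) ^ 11) := by rw [Real.exp_add, hpow]
      _ ≤ 3 * (1 / (n : ℝ) ^ 11) := by gcongr; linarith [Real.exp_one_lt_d9]
      _ = _ := by ring
  have t5 : b / (n : ℝ) ^ 11 + 2 / (n : ℝ) ^ 11 + 3 / (n : ℝ) ^ 11 ≤ 1 / (n : ℝ) ^ 10 := by
    rw [← add_div, ← add_div]
    calc _ ≤ (n : ℝ) / (n : ℝ) ^ 11 := by gcongr; linarith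
      _ = _ := by field_simp
  linarith

end GreedyD

/-! ### The theorem -/

theorem mainTheorem6 (d : ℝ) (hd : 1 < d) :
    (∃ a b : ℝ, GreedyD.PotentialBound d hd a b) ∧
    ∀ a b : ℝ, GreedyD.PotentialBound d hd a b →
      ∃ γ : ℝ, ∀ (n : ℕ) [NeZero n], 2 ≤ n → ∀ k : ℝ, 0 ≤ k →
        ∀ t : ℕ, 12 * Real.log n / a ≤ (t : ℝ) →
          (GreedyD.lawAt n d hd t).real
              {x | (5 + 10 / a) * Real.log (Real.log n) + k + γ ≤ GreedyD.gap t x}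
            ≤ 1 / (n : ℝ) ^ 10 + Real.exp (-(a * k)) / Real.log n ^ 4 := by
  refine ⟨GreedyD.exists_potentialBound hd, fun a b hp => ?_⟩
  have ha := hp.1
  have hb := hp.one_le
  obtain ⟨γ₁, N, hlarge⟩ := hp.gap_tail_of_large
  -- For the finitely many `n < N`, `γ` is enlarged until the Markov bound alone gives `exp (-(a *
  -- k)) / log n ^ 4`.
  set g : ℕ → ℝ := fun n =>
    |Real.log (b * n * Real.log n ^ 4) / a - (5 + 10 / a) * Real.log (Real.log n)| with hg
  have hg0 : 0 ≤ ∑ j ∈ Finset.range N, g j := Finset.sum_nonneg fun j _ => abs_nonneg _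
  refine ⟨|γ₁| + ∑ j ∈ Finset.range N, g j, fun n _ hn k hk t ht => ?_⟩
  rcases le_or_gt N n with hNn | hnN
  · exact hlarge n hNn k hk t ht _ (by linarith [le_abs_self γ₁])
  · have hn1 : (1 : ℝ) < n := by exact_mod_cast hn
    have hL : 0 < Real.log n := Real.log_pos hn1
    have h1 : g n ≤ ∑ j ∈ Finset.range N, g j :=
      Finset.single_le_sum (fun j _ => abs_nonneg _) (Finset.mem_range.mpr hnN)
    have h2 : Real.log (b * n * Real.log n ^ 4) / a - (5 + 10 / a) * Real.log (Real.log n) ≤ g n :=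
      le_abs_self _
    set y := (5 + 10 / a) * Real.log (Real.log n) + k + (|γ₁| + ∑ j ∈ Finset.range N, g j) with hy
    have h3 : Real.log (b * n * Real.log n ^ 4) + a * k ≤ a * y := by
      have h4 : Real.log (b * n * Real.log n ^ 4) / a + k ≤ y := by
        linarith [abs_nonneg γ₁]
      have := mul_le_mul_of_nonneg_left h4 ha.le
      rwa [mul_add, mul_div_cancel₀ _ ha.ne'] at this
    have h5 : Real.exp (-(a * y)) ≤ (b * n * Real.log n ^ 4)⁻¹ * Real.exp (-(a * k)) := by
      have h6 : 0 < b * n * Real.log n ^ 4 := by positivity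
      calc _ ≤ Real.exp (-Real.log (b * n * Real.log n ^ 4) + -(a * k)) :=
            Real.exp_le_exp.mpr (by linarith)
        _ = _ := by rw [Real.exp_add, Real.exp_neg, Real.exp_log h6]
    have h7 : Real.exp (-(a * y)) * (b * n) ≤ Real.exp (-(a * k)) / Real.log n ^ 4 := by
      calc _ ≤ (b * n * Real.log n ^ 4)⁻¹ * Real.exp (-(a * k)) * (b * n) := by gcongr
        _ = _ := by field_simp
    have h8 : (0 : ℝ) ≤ 1 / (n : ℝ) ^ 10 := by positivity
    linarith [hp.gap_tail_le (n := n) t y]
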